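/- Consider a discrete memoryless two-way channel with finite input alphabets $\mathcal X_1,\mathcal X_2$, finite output alphabets $\mathcal Y_1,\mathcal Y_2$ and transition probability $P_{Y_1,Y_2|X_1,X_2}$, with marginal channels $P_{Y_1|X_1,X_2}$ and $P_{Y_2|X_1,X_2}$. Let $\mathcal P(\mathcal X)$ be the set of probability distributions on $\mathcal X$. All logarithms are to base $2$. An $(n,R_1,R_2)$ code ($R_1,R_2\ge 0$) has message sets $\mathcal M_j=\{1,\dots,\lfloor 2^{nR_j}\rfloor\}$, encoders $X_{j,i}=f_{j,i}(M_j,Y_j^{i-1})$ for $j=1,2$ and $1\le i\le n$, and decoders $\hat M_2=g_1(M_1,Y_1^n)$, $\hat M_1=g_2(M_2,Y_2^n)$. The messages $M_1,M_2$ are independent and uniform, and the error probability is $P_e^{(n)}=\Pr\{\hat M_1\ne M_1\text{ or }\hat M_2\ne M_2\}$. A pair $(R_1,R_2)$ of nonnegative reals is achievable if there is a sequence of $(n,R_1,R_2)$ codes with $P_e^{(n)}\to0$ as $n\to\infty$. The capacity region $\mathcal C$ is $\overline{\mathrm{co}}$ of the set of achievable pairs, where $\overline{\mathrm{co}}$ denotes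 the closure of the convex hull. For an input distribution $P_{X_1,X_2}$ let $$\mathcal R(P_{X_1,X_2})=\{(R_1,R_2): 0\le R_1\le I(X_1;Y_2|X_2),\ 0\le R_2\le I(X_2;Y_1|X_1)\},$$ and let $$\mathcal C_{\mathrm I}=\overline{\mathrm{co}}\Big(\bigcup_{P_{X_1},P_{X_2}}\mathcal R(P_{X_1}\cdot P_{X_2})\Big),\qquad \mathcal C_{\mathrm O}=\overline{\mathrm{co}}\Big(\bigcup_{P_{X_1,X_2}}\mathcal R(P_{X_1,X_2})\Big)$$ be Shannon's inner and outer bounds. **Theorem 4.** Suppose that there is $P^*_{X_1}\in\mathcal P(\mathcal X_1)$ such that both of the following conditions hold. (i) For every $x_2\in\mathcal X_2$, $P^*_{X_1}$ maximizes $I(X_1;Y_2|X_2=x_2)$ over all $P_{X_1|X_2=x_2}\in\mathcal P(\mathcal X_1)$ (it need not be the only maximizer). (ii) $H(Y_1|X_1,X_2)$ does not depend on $P_{X_1|X_2}$ given $P_{X_2}$; that is, it takes the same value for any two input distributions with the same marginal $P_{X_2}$. Moreover, for every input distribution $P^{(1)}_{X_1,X_2}$ with second marginal $P^{(1)}_{X_2}$,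 one has $H^{(1)}(Y_1|X_1)\le H^{(2)}(Y_1|X_1)$, where the two sides are evaluated under $P^{(1)}_{X_1,X_2}$ and under $P^{(2)}_{X_1,X_2}=P^*_{X_1}\cdot P^{(1)}_{X_2}$ respectively. Then $\mathcal C=\mathcal C_{\mathrm I}=\mathcal C_{\mathrm O}$, and $$\mathcal C=\overline{\mathrm{co}}\Big(\bigcup_{P_{X_2}\in\mathcal P(\mathcal X_2)}\mathcal R(P^*_{X_1}\cdot P_{X_2})\Big).$$ -/

import Mathlib

namespace TWC

/-- Probability distributions on a finite set `A`. -/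
abbrev ProbDist (A : Type*) [Fintype A] : Type _ := ↥(stdSimplex ℝ A)

/-- Product distribution `P · Q` of independent inputs. -/
def ProbDist.prod {A B : Type*} [Fintype A] [Fintype B] (P : ProbDist A) (Q : ProbDist B) :
    ProbDist (A × B) :=
  ⟨fun z => P.1 z.1 * Q.1 z.2, fun z => mul_nonneg (P.2.1 z.1) (Q.2.1 z.2), by
    rw [Fintype.sum_prod_type]
    simp only [← Finset.mul_sum, Q.2.2, mul_one, P.2.2]⟩

/-- Second marginal of a joint distribution. -/
def ProbDist.snd {A B : Type*} [Fintype A] [Fintype B] (P : ProbDist (A × B)) : ProbDist B :=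
  ⟨fun b => ∑ a, P.1 (a, b), fun b => Finset.sum_nonneg fun a _ => P.2.1 (a, b), by
    rw [← Fintype.sum_prod_type_right]
    exact P.2.2⟩

/-! ### Information quantities, in bits -/

/-- The functional `𝓘(P_X, P_{Y|X})`: mutual information between an input with distribution `P`
and the output of the channel with transition probability `V` (terms with `P x * V x y = 0`
contribute `0`). -/
noncomputable def mutualInfo {A B : Type*} [Fintype A] [Fintype B] (P : A → ℝ) (V : A → B → ℝ) :
    ℝ :=
  ∑ x, ∑ y, P x * V x y * Real.logb 2 (V x y / ∑ x', P x' * V x' y)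

/-- Conditional entropy `H(B | A)` under the joint probability mass function `p a b`. -/
noncomputable def condEntropy {A B : Type*} [Fintype A] [Fintype B] (p : A → B → ℝ) : ℝ :=
  -∑ a, ∑ b, p a b * Real.logb 2 (p a b / ∑ b', p a b')

/-- Conditional mutual information `I(A; B | C)` under the joint probability mass function
`p a b c`. -/
noncomputable def condMutualInfo {A B C : Type*} [Fintype A] [Fintype B] [Fintype C]
    (p : A → B → C → ℝ) : ℝ :=
  ∑ a, ∑ b, ∑ c, p a b c *
    Real.logb 2 ((p a b c * ∑ a', ∑ b', p a' b' c) / ((∑ b', p a b' c) * ∑ a', p a' b c))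

/-! ### Memoryless two-way channels -/

/-- Transition probability `P_{Y₁,Y₂|X₁,X₂}` of a memoryless two-way channel. -/
abbrev Channel (X₁ X₂ Y₁ Y₂ : Type*) [Fintype Y₁] [Fintype Y₂] := X₁ → X₂ → ProbDist (Y₁ × Y₂)

section Region

variable {X₁ X₂ Y₁ Y₂ : Type*} [Fintype X₁] [Fintype X₂] [Fintype Y₁] [Fintype Y₂]

/-- Marginal channel `P_{Y₁|X₁,X₂}`. -/
def Channel.toUser1 (W : Channel X₁ X₂ Y₁ Y₂) (x₁ : X₁) (x₂ : X₂) (y₁ : Y₁) : ℝ :=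
  ∑ y₂, (W x₁ x₂).1 (y₁, y₂)

/-- Marginal channel `P_{Y₂|X₁,X₂}`. -/
def Channel.toUser2 (W : Channel X₁ X₂ Y₁ Y₂) (x₁ : X₁) (x₂ : X₂) (y₂ : Y₂) : ℝ :=
  ∑ y₁, (W x₁ x₂).1 (y₁, y₂)

/-- `I(X₁; Y₂ | X₂)` under the input distribution `P`. -/
noncomputable def infoX1Y2 (P : ProbDist (X₁ × X₂)) (W : Channel X₁ X₂ Y₁ Y₂) : ℝ :=
  condMutualInfo fun (x₁ : X₁) (y₂ : Y₂) (x₂ : X₂) => P.1 (x₁, x₂) * W.toUser2 x₁ x₂ y₂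

/-- `I(X₂; Y₁ | X₁)` under the input distribution `P`. -/
noncomputable def infoX2Y1 (P : ProbDist (X₁ × X₂)) (W : Channel X₁ X₂ Y₁ Y₂) : ℝ :=
  condMutualInfo fun (x₂ : X₂) (y₁ : Y₁) (x₁ : X₁) => P.1 (x₁, x₂) * W.toUser1 x₁ x₂ y₁

/-- `H(Y₁ | X₁)` under the input distribution `P`. -/
noncomputable def entropyY1X1 (P : ProbDist (X₁ × X₂)) (W : Channel X₁ X₂ Y₁ Y₂) : ℝ :=
  condEntropy fun (x₁ : X₁) (y₁ : Y₁) => ∑ x₂, P.1 (x₁, x₂) * W.toUser1 x₁ x₂ y₁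

/-- `H(Y₁ | X₁, X₂)` under the input distribution `P`. -/
noncomputable def entropyY1X1X2 (P : ProbDist (X₁ × X₂)) (W : Channel X₁ X₂ Y₁ Y₂) : ℝ :=
  condEntropy fun (x : X₁ × X₂) (y₁ : Y₁) => P.1 x * W.toUser1 x.1 x.2 y₁

/-- The set `𝓡(P, W)` of (nonnegative) rate pairs. -/
def rateRegion (P : ProbDist (X₁ × X₂)) (W : Channel X₁ X₂ Y₁ Y₂) : Set (ℝ × ℝ) :=
  {R | 0 ≤ R.1 ∧ 0 ≤ R.2 ∧ R.1 ≤ infoX1Y2 P W ∧ R.2 ≤ infoX2Y1 P W}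

/-- Closure of the convex hull. -/
def coBar (S : Set (ℝ × ℝ)) : Set (ℝ × ℝ) := closure (convexHull ℝ S)

/-- Shannon's inner bound `𝓒_I`. -/
def innerBound (W : Channel X₁ X₂ Y₁ Y₂) : Set (ℝ × ℝ) :=
  coBar (⋃ (P₁ : ProbDist X₁) (P₂ : ProbDist X₂), rateRegion (P₁.prod P₂) W)

/-- Shannon's outer bound `𝓒_O`. -/
def outerBound (W : Channel X₁ X₂ Y₁ Y₂) : Set (ℝ × ℝ) :=
  coBar (⋃ P : ProbDist (X₁ × X₂), rateRegion P W)

end Region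

/-! ### Codes and the capacity region -/

/-- The number of integers in `{1, 2, …, 2^{nR}}`. -/
noncomputable def numMessages (n : ℕ) (R : ℝ) : ℕ := ⌊(2 : ℝ) ^ ((n : ℝ) * R)⌋₊

/-- An `(n, R₁, R₂)` code with feedback-adaptive encoders. At time `i` (counted from `0`) a user's
input depends on its own message and on the `i` outputs it has received before. -/
structure Code (X₁ X₂ Y₁ Y₂ : Type*) (n : ℕ) (R₁ R₂ : ℝ) where
  enc₁ : (i : Fin n) → Fin (numMessages n R₁) → (Fin i → Y₁) → X₁
  enc₂ : (i : Fin n) → Fin (numMessages n R₂) → (Fin i → Y₂) → X₂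
  /-- User 1's estimate of user 2's message. -/
  dec₁ : Fin (numMessages n R₁) → (Fin n → Y₁) → Fin (numMessages n R₂)
  /-- User 2's estimate of user 1's message. -/
  dec₂ : Fin (numMessages n R₂) → (Fin n → Y₂) → Fin (numMessages n R₁)

/-- The outputs strictly before time `i`. -/
def past {Y : Type*} {n : ℕ} (y : Fin n → Y) (i : Fin n) : Fin i → Y :=
  fun j => y (Fin.castLE i.isLt.le j)

section Capacity

variable {X₁ X₂ Y₁ Y₂ : Type*} [Fintype Y₁] [Fintype Y₂]

/-- Probability that the messages `m₁, m₂` produce the output sequences `y₁, y₂` over the memoryless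
channel `W`. -/
def Code.outputProb {n : ℕ} {R₁ R₂ : ℝ} (c : Code X₁ X₂ Y₁ Y₂ n R₁ R₂) (W : Channel X₁ X₂ Y₁ Y₂)
    (m₁ : Fin (numMessages n R₁)) (m₂ : Fin (numMessages n R₂))
    (y₁ : Fin n → Y₁) (y₂ : Fin n → Y₂) : ℝ :=
  ∏ i : Fin n, (W (c.enc₁ i m₁ (past y₁ i)) (c.enc₂ i m₂ (past y₂ i))).1 (y₁ i, y₂ i)

/-- Probability of decoding error for independent, uniformly distributed messages. -/
noncomputable def Code.errorProb {n : ℕ} {R₁ R₂ : ℝ} (c : Code X₁ X₂ Y₁ Y₂ n R₁ R₂)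
    (W : Channel X₁ X₂ Y₁ Y₂) : ℝ :=
  ∑ m₁, ∑ m₂, (numMessages n R₁ : ℝ)⁻¹ * (numMessages n R₂ : ℝ)⁻¹ *
    ∑ y₁ : Fin n → Y₁, ∑ y₂ : Fin n → Y₂,
      if c.dec₂ m₂ y₂ ≠ m₁ ∨ c.dec₁ m₁ y₁ ≠ m₂ then c.outputProb W m₁ m₂ y₁ y₂ else 0

/-- Achievability of a rate pair. -/
def Achievable (W : Channel X₁ X₂ Y₁ Y₂) (R : ℝ × ℝ) : Prop :=
  0 ≤ R.1 ∧ 0 ≤ R.2 ∧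
    ∃ c : (n : ℕ) → Code X₁ X₂ Y₁ Y₂ n R.1 R.2,
      Filter.Tendsto (fun n => (c n).errorProb W) Filter.atTop (nhds 0)

/-- The capacity region `𝓒`. -/
def capacityRegion (W : Channel X₁ X₂ Y₁ Y₂) : Set (ℝ × ℝ) :=
  coBar {R | Achievable W R}

end Capacity

end TWC

-- Shannon's bounds `innerBound W ⊆ capacityRegion W ⊆ outerBound W` hold for every channel, and the
-- two conditions make them meet. For a joint input law `P`, I(X₁;Y₂|X₂) is an average over `x₂` of
-- informations through the channel with `x₂` frozen, so replacing each conditional law of X₁ by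
-- `Pstar` cannot decrease it. In I(X₂;Y₁|X₁) = H(Y₁|X₁) − H(Y₁|X₁,X₂), the same replacement fixes
-- the second entropy and does not decrease the first. Hence the region of `P` lies in that of
-- `Pstar.prod P.snd` (`rateRegion_subset_of_conditions`), so the outer bound lies in the hull of
-- such product regions, which lies in the inner bound.
--
-- The outer bound rests on one change of measure (`prob_correct_mul_log_card_le`), in place of
-- entropy chain rules and Fano's inequality. The law of messages and outputs is compared with a
-- sub-probability in which each output of the decoding user depends on that user's own input alone,
-- tilted towards correct decoding. Nonnegativity of divergence bounds Pr(correct) · log|M| − 1 by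
-- the sum of the per-letter conditional informations; feedback enters only through the joint input
-- laws. Time averages of these informations give points of the convex hull.
--
-- The inner bound uses two independent random codebooks that ignore the received outputs. Each user
-- knows its own codeword, so each direction is a one-way channel with side information at the
-- decoder. A likelihood threshold, a union bound and Chebyshev's inequality give every pair
-- strictly below the informations (`achievable_of_lt_info`); closure gives the rest.

namespace TWC

-- Forms of conditional mutual information.

section Information

variable {A B C : Type*} [Fintype A]

/-- Conditional output distribution `P_{B|C}` induced by the joint input distribution `P` and the
channel `V`. -/
noncomputable def outputGiven (P : A → C → ℝ) (V : A → C → B → ℝ) (c : C) (b : B) : ℝ :=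
  (∑ a, P a c * V a c b) / ∑ a, P a c

theorem sum_pos_of_mem_support {P : A → ℝ} (hP : ∀ a, 0 ≤ P a) {a : A} (h : P a ≠ 0) :
    0 < ∑ a, P a :=
  Finset.sum_pos' (fun a _ => hP a) ⟨a, Finset.mem_univ a, lt_of_le_of_ne (hP a) h.symm⟩

theorem outputGiven_pos {P : A → C → ℝ} {V : A → C → B → ℝ} (hP : ∀ a c, 0 ≤ P a c)
    (hV : ∀ a c b, 0 ≤ V a c b) {a : A} {b : B} {c : C} (h : P a c ≠ 0) (h' : V a c b ≠ 0) :
    0 < outputGiven P V c b :=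
  div_pos (sum_pos_of_mem_support (fun a => mul_nonneg (hP a c) (hV a c b)) (mul_ne_zero h h'))
    (sum_pos_of_mem_support (fun a => hP a c) h)

variable [Fintype B] [Fintype C]

theorem condMutualInfo_eq_sum_log {P : A → C → ℝ} {V : A → C → B → ℝ}
    (hV1 : ∀ a c, ∑ b, V a c b = 1) :
    condMutualInfo (fun a b c => P a c * V a c b) =
      ∑ a, ∑ c, ∑ b, P a c * V a c b * Real.logb 2 (V a c b / outputGiven P V c b) := by
  unfold condMutualInfo
  refine Finset.sum_congr rfl fun a _ => ?_
  rw [Finset.sum_comm]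
  refine Finset.sum_congr rfl fun c _ => Finset.sum_congr rfl fun b _ => ?_
  by_cases h : P a c = 0
  · simp [h]
  simp only [← Finset.mul_sum, hV1, mul_one, outputGiven]
  congr 2
  rw [div_div_eq_mul_div, mul_assoc, mul_div_mul_left _ _ h]

/-- Exposes, for each `c`, the quantity that condition (i) maximizes. Values `c` of mass zero
contribute nothing, so the undefined conditional law there is harmless. -/
theorem condMutualInfo_eq_sum_mutualInfo {P : A → C → ℝ} {V : A → C → B → ℝ}
    (hP : ∀ a c, 0 ≤ P a c) (hV1 : ∀ a c, ∑ b, V a c b = 1) :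
    condMutualInfo (fun a b c => P a c * V a c b) =
      ∑ c, (∑ a, P a c) * mutualInfo (fun a => P a c / ∑ a, P a c) (fun a b => V a c b) := by
  rw [condMutualInfo_eq_sum_log hV1, Finset.sum_comm]
  refine Finset.sum_congr rfl fun c _ => ?_
  simp only [mutualInfo, Finset.mul_sum]
  refine Finset.sum_congr rfl fun a _ => Finset.sum_congr rfl fun b _ => ?_
  by_cases h : P a c = 0
  · simp [h]
  have h0 := (sum_pos_of_mem_support (fun a => hP a c) h).ne'
  simp only [outputGiven, Finset.sum_div, div_mul_eq_mul_div]
  field_simp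

theorem condMutualInfo_eq_condEntropy_sub {P : A → C → ℝ} {V : A → C → B → ℝ}
    (hP : ∀ a c, 0 ≤ P a c) (hV : ∀ a c b, 0 ≤ V a c b) (hV1 : ∀ a c, ∑ b, V a c b = 1) :
    condMutualInfo (fun a b c => P a c * V a c b) =
      condEntropy (fun c b => ∑ a, P a c * V a c b) -
        condEntropy (fun (x : C × A) b => P x.2 x.1 * V x.2 x.1 b) := by
  have h1 : condEntropy (fun c b => ∑ a, P a c * V a c b) =
      -∑ c, ∑ a, ∑ b, P a c * V a c b * Real.logb 2 (outputGiven P V c b) := by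
    unfold condEntropy
    congr 1
    refine Finset.sum_congr rfl fun c _ => ?_
    have hs : ∑ b, ∑ a, P a c * V a c b = ∑ a, P a c := by
      rw [Finset.sum_comm]
      simp only [← Finset.mul_sum, hV1, mul_one]
    rw [hs, Finset.sum_comm]
    simp only [← Finset.sum_mul, outputGiven]
  have h2 : condEntropy (fun (x : C × A) b => P x.2 x.1 * V x.2 x.1 b) =
      -∑ c, ∑ a, ∑ b, P a c * V a c b * Real.logb 2 (V a c b) := by
    unfold condEntropy
    rw [Fintype.sum_prod_type]
    congr 1
    refine Finset.sum_congr rfl fun c _ => Finset.sum_congr rfl fun a _ =>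
      Finset.sum_congr rfl fun b _ => ?_
    by_cases h : P a c = 0
    · simp [h]
    simp only [← Finset.mul_sum, hV1, mul_one]
    rw [mul_div_cancel_left₀ _ h]
  rw [condMutualInfo_eq_sum_log hV1, h1, h2, Finset.sum_comm, neg_sub_neg]
  simp only [← Finset.sum_sub_distrib]
  refine Finset.sum_congr rfl fun c _ => Finset.sum_congr rfl fun a _ =>
    Finset.sum_congr rfl fun b _ => ?_
  -- Splitting the logarithm of the quotient needs both factors nonzero; all other terms carry
  -- weight zero.
  by_cases h : P a c = 0
  · simp [h]
  by_cases h' : V a c b = 0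
  · simp [h']
  rw [Real.logb_div h' (outputGiven_pos hP hV h h').ne', mul_sub]

end Information

-- Effect of the two conditions on a single rate region.

section Channel

variable {X₁ X₂ Y₁ Y₂ : Type*} [Fintype Y₁] [Fintype Y₂]

theorem Channel.toUser1_nonneg (W : Channel X₁ X₂ Y₁ Y₂) (x₁ : X₁) (x₂ : X₂) (y : Y₁) :
    0 ≤ W.toUser1 x₁ x₂ y :=
  Finset.sum_nonneg fun _ _ => (W x₁ x₂).2.1 _

theorem Channel.toUser2_nonneg (W : Channel X₁ X₂ Y₁ Y₂) (x₁ : X₁) (x₂ : X₂) (y : Y₂) :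
    0 ≤ W.toUser2 x₁ x₂ y :=
  Finset.sum_nonneg fun _ _ => (W x₁ x₂).2.1 _

theorem Channel.sum_toUser1 (W : Channel X₁ X₂ Y₁ Y₂) (x₁ : X₁) (x₂ : X₂) :
    ∑ y, W.toUser1 x₁ x₂ y = 1 := by
  simp only [Channel.toUser1, ← Fintype.sum_prod_type', (W x₁ x₂).2.2]

theorem Channel.sum_toUser2 (W : Channel X₁ X₂ Y₁ Y₂) (x₁ : X₁) (x₂ : X₂) :
    ∑ y, W.toUser2 x₁ x₂ y = 1 := by
  simp only [Channel.toUser2, ← Fintype.sum_prod_type_right', (W x₁ x₂).2.2]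

variable [Fintype X₁] [Fintype X₂]

theorem infoX2Y1_eq (P : ProbDist (X₁ × X₂)) (W : Channel X₁ X₂ Y₁ Y₂) :
    infoX2Y1 P W = entropyY1X1 P W - entropyY1X1X2 P W :=
  condMutualInfo_eq_condEntropy_sub (P := fun x₂ x₁ => P.1 (x₁, x₂))
    (V := fun x₂ x₁ y => W.toUser1 x₁ x₂ y) (fun _ _ => P.2.1 _)
    (fun _ _ _ => W.toUser1_nonneg _ _ _) (fun _ _ => W.sum_toUser1 _ _)

theorem ProbDist.snd_prod (P : ProbDist X₁) (Q : ProbDist X₂) : (P.prod Q).snd = Q := by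
  ext b
  simp [ProbDist.snd, ProbDist.prod, ← Finset.sum_mul, P.2.2]

/-- Both input laws give `x₂` the same weight, so the averages over `x₂` compare term by term, with
`hmax` applied to the conditional law of X₁. -/
theorem infoX1Y2_le_of_maximizer (W : Channel X₁ X₂ Y₁ Y₂) (Pstar : ProbDist X₁)
    (hmax : ∀ (x₂ : X₂) (Q : ProbDist X₁),
      mutualInfo Q.1 (fun x₁ => W.toUser2 x₁ x₂) ≤ mutualInfo Pstar.1 (fun x₁ => W.toUser2 x₁ x₂))
    (P : ProbDist (X₁ × X₂)) : infoX1Y2 P W ≤ infoX1Y2 (Pstar.prod P.snd) W := by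
  unfold infoX1Y2
  rw [condMutualInfo_eq_sum_mutualInfo (P := fun x₁ x₂ => P.1 (x₁, x₂))
      (V := fun x₁ x₂ y => W.toUser2 x₁ x₂ y) (fun _ _ => P.2.1 _) (fun _ _ => W.sum_toUser2 _ _),
    condMutualInfo_eq_sum_mutualInfo (P := fun x₁ x₂ => (Pstar.prod P.snd).1 (x₁, x₂))
      (V := fun x₁ x₂ y => W.toUser2 x₁ x₂ y) (fun _ _ => (Pstar.prod P.snd).2.1 _)
      (fun _ _ => W.sum_toUser2 _ _)]
  refine Finset.sum_le_sum fun c _ => ?_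
  have hs : ∑ a, (Pstar.prod P.snd).1 (a, c) = ∑ a, P.1 (a, c) := by
    simp only [ProbDist.prod, ProbDist.snd, ← Finset.sum_mul, Pstar.2.2, one_mul]
  rw [hs]
  have h0 : 0 ≤ ∑ a, P.1 (a, c) := Finset.sum_nonneg fun a _ => P.2.1 _
  -- If `x₂` has mass zero there is no conditional law to compare, but both terms vanish.
  rcases h0.eq_or_lt with h | h
  · rw [← h]; simp
  refine mul_le_mul_of_nonneg_left ?_ h0
  have := hmax c ⟨fun a => P.1 (a, c) / ∑ a, P.1 (a, c), fun a => div_nonneg (P.2.1 _) h0, by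
    rw [← Finset.sum_div, div_self h.ne']⟩
  have e : (fun a => (Pstar.prod P.snd).1 (a, c) / ∑ a, P.1 (a, c)) = Pstar.1 :=
    funext fun a => mul_div_cancel_right₀ _ h.ne'
  rwa [e]

theorem rateRegion_subset_of_conditions (W : Channel X₁ X₂ Y₁ Y₂) (Pstar : ProbDist X₁)
    (hmax : ∀ (x₂ : X₂) (Q : ProbDist X₁),
      mutualInfo Q.1 (fun x₁ => W.toUser2 x₁ x₂) ≤ mutualInfo Pstar.1 (fun x₁ => W.toUser2 x₁ x₂))
    (hinv : ∀ P Q : ProbDist (X₁ × X₂), P.snd = Q.snd → entropyY1X1X2 P W = entropyY1X1X2 Q W)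
    (hent : ∀ P : ProbDist (X₁ × X₂), entropyY1X1 P W ≤ entropyY1X1 (Pstar.prod P.snd) W)
    (P : ProbDist (X₁ × X₂)) : rateRegion P W ⊆ rateRegion (Pstar.prod P.snd) W := by
  rintro R ⟨h1, h2, h3, h4⟩
  refine ⟨h1, h2, h3.trans (infoX1Y2_le_of_maximizer W Pstar hmax P), h4.trans ?_⟩
  rw [infoX2Y1_eq, infoX2Y1_eq, hinv P (Pstar.prod P.snd) (ProbDist.snd_prod _ _).symm]
  exact sub_le_sub_right (hent P) _

end Channel

theorem coBar_subset_coBar {S T : Set (ℝ × ℝ)} (h : S ⊆ coBar T) : coBar S ⊆ coBar T :=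
  closure_minimal (convexHull_min h (convex_convexHull ℝ T).closure) isClosed_closure

theorem subset_coBar (S : Set (ℝ × ℝ)) : S ⊆ coBar S :=
  (subset_convexHull ℝ S).trans subset_closure

-- Sequences generated causally.

section Causal

variable {Z : Type*}

theorem past_snoc_castSucc {n : ℕ} (z : Fin n → Z) (w : Z) (i : Fin n) :
    past (Fin.snoc z w : Fin (n + 1) → Z) i.castSucc = past z i := by
  funext j
  exact Fin.snoc_castSucc (α := fun _ => Z) w z (Fin.castLE i.isLt.le j)

theorem past_snoc_last {n : ℕ} (z : Fin n → Z) (w : Z) :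
    past (Fin.snoc z w : Fin (n + 1) → Z) (Fin.last n) = z := by
  funext j
  exact Fin.snoc_castSucc (α := fun _ => Z) w z j

/-- Probability of the sequence `z` when `K i` gives the law of the `i`-th entry conditionally on
the previous ones. -/
def causalProb {n : ℕ} (K : (i : Fin n) → (Fin i → Z) → Z → ℝ) (z : Fin n → Z) : ℝ :=
  ∏ i, K i (past z i) (z i)

theorem causalProb_nonneg {n : ℕ} {K : (i : Fin n) → (Fin i → Z) → Z → ℝ}
    (hK : ∀ i h w, 0 ≤ K i h w) (z : Fin n → Z) : 0 ≤ causalProb K z :=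
  Finset.prod_nonneg fun _ _ => hK _ _ _

theorem causalProb_snoc {n : ℕ} (K : (i : Fin (n + 1)) → (Fin i → Z) → Z → ℝ) (z : Fin n → Z)
    (w : Z) : causalProb K (Fin.snoc z w : Fin (n + 1) → Z) =
      causalProb (fun i : Fin n => K i.castSucc) z * K (Fin.last n) z w := by
  unfold causalProb
  rw [Fin.prod_univ_castSucc]
  simp only [past_snoc_castSucc, Fin.snoc_castSucc, Fin.snoc_last]
  rw [past_snoc_last]

variable [Fintype Z]

theorem sum_fin_succ_snoc {n : ℕ} (F : (Fin (n + 1) → Z) → ℝ) :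
    ∑ z, F z = ∑ z : Fin n → Z, ∑ w, F (Fin.snoc z w : Fin (n + 1) → Z) := by
  rw [← (Fin.snocEquiv fun _ : Fin (n + 1) => Z).sum_comp, Fintype.sum_prod_type_right]
  rfl

theorem sum_causalProb_eq_one {n : ℕ} (K : (i : Fin n) → (Fin i → Z) → Z → ℝ)
    (hK : ∀ i h, ∑ w, K i h w = 1) : ∑ z, causalProb K z = 1 := by
  induction n with
  | zero => simp [causalProb]
  | succ n ih =>
    rw [sum_fin_succ_snoc]
    simp only [causalProb_snoc, ← Finset.mul_sum]
    have := hK (Fin.last n)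
    simp only [Fin.val_last] at this
    simp only [this, mul_one]
    exact ih _ fun i h => hK i.castSucc h

/-- The conditional laws of the converse are quotients that become zero where the denominator
vanishes, so only subnormalized kernels are available there. -/
theorem sum_causalProb_le_one {n : ℕ} (K : (i : Fin n) → (Fin i → Z) → Z → ℝ)
    (hK0 : ∀ i h w, 0 ≤ K i h w) (hK : ∀ i h, ∑ w, K i h w ≤ 1) : ∑ z, causalProb K z ≤ 1 := by
  induction n with
  | zero => simp [causalProb]
  | succ n ih =>
    rw [sum_fin_succ_snoc]
    simp only [causalProb_snoc, ← Finset.mul_sum]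
    refine le_trans (Finset.sum_le_sum fun z _ => ?_)
      (ih (fun i : Fin n => K i.castSucc) (fun i => hK0 i.castSucc) fun i h => hK i.castSucc h)
    exact mul_le_of_le_one_right (causalProb_nonneg (fun i : Fin n => hK0 i.castSucc) z)
      (hK (Fin.last n) z)

/-- Tower property: the entries after `i` sum to one and drop out, and entry `i` is averaged given
its past. -/
theorem sum_causalProb_mul {n : ℕ} (K : (i : Fin n) → (Fin i → Z) → Z → ℝ)
    (hK : ∀ i h, ∑ w, K i h w = 1) (i : Fin n) (φ : (Fin i → Z) → Z → ℝ) :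
    ∑ z, causalProb K z * φ (past z i) (z i) =
      ∑ z, causalProb K z * ∑ w, K i (past z i) w * φ (past z i) w := by
  induction n with
  | zero => exact i.elim0
  | succ n ih =>
    have hlast : ∀ z : Fin n → Z, ∑ w, K (Fin.last n) z w = 1 := hK (Fin.last n)
    rw [sum_fin_succ_snoc, sum_fin_succ_snoc]
    simp only [causalProb_snoc]
    induction i using Fin.lastCases with
    | last =>
      refine Finset.sum_congr rfl fun z _ => ?_
      simp only [Fin.snoc_last]
      have hφ : ∀ w, (∑ v, K (Fin.last n) (past (Fin.snoc z w : Fin (n + 1) → Z) (Fin.last n)) v *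
          φ (past (Fin.snoc z w : Fin (n + 1) → Z) (Fin.last n)) v) =
          ∑ v, K (Fin.last n) z v * φ z v := fun w => by rw [past_snoc_last]
      have hφ' : ∀ w, φ (past (Fin.snoc z w : Fin (n + 1) → Z) (Fin.last n)) w = φ z w :=
        fun w => by rw [past_snoc_last]
      simp only [hφ, hφ', ← Finset.sum_mul, mul_assoc, ← Finset.mul_sum]
      rw [hlast, one_mul]
    | cast i =>
      simp only [past_snoc_castSucc, Fin.snoc_castSucc, mul_right_comm _ (K (Fin.last n) _ _),
        ← Finset.mul_sum, hlast, mul_one]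
      exact ih (fun i : Fin n => K i.castSucc) (fun i => hK i.castSucc) i φ

end Causal

theorem sum_indicator_mul {Ω A B : Type*} [Fintype Ω] [Fintype A] [Fintype B] [DecidableEq A]
    [DecidableEq B] (p : Ω → ℝ) (f : Ω → A) (g : Ω → B) (G : A → B → ℝ) :
    ∑ a, ∑ b, (∑ ω, if f ω = a ∧ g ω = b then p ω else 0) * G a b =
      ∑ ω, p ω * G (f ω) (g ω) := by
  simp only [Finset.sum_mul]
  rw [Finset.sum_congr rfl fun a _ => Finset.sum_comm, Finset.sum_comm]
  refine Finset.sum_congr rfl fun ω _ => ?_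
  rw [Finset.sum_eq_single (f ω), Finset.sum_eq_single (g ω)]
  · simp
  · intro b _ hb; simp [hb.symm]
  · simp
  · intro a _ ha; simp [ha.symm]
  · simp

/-- Pointwise form of the nonnegativity of divergence, from `log x ≥ 1 - 1/x`. The value `l` is
prescribed only where `p > 0`, so formulas valid only on the support may be used. -/
theorem le_mul_logb_of_pos {p r l : ℝ} (hp : 0 ≤ p) (hr : 0 ≤ r)
    (h : 0 < p → 0 < r ∧ l = Real.logb 2 (p / r)) : (p - r) / Real.log 2 ≤ p * l := by
  have h2 : 0 < Real.log 2 := Real.log_pos one_lt_two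
  rcases hp.eq_or_lt with rfl | hp
  · rw [zero_mul]; exact div_nonpos_of_nonpos_of_nonneg (by linarith) h2.le
  obtain ⟨hr, rfl⟩ := h hp
  rw [Real.logb, mul_div_assoc']
  refine div_le_div_of_nonneg_right ?_ h2.le
  have := Real.one_sub_inv_le_log_of_pos (div_pos hp hr)
  have h3 := mul_le_mul_of_nonneg_left this hp.le
  rw [inv_div, mul_sub, mul_div_cancel₀ _ hp.ne', mul_one] at h3
  exact h3

-- Converse by change of measure, in one direction.

section Converse

variable {X X' Y Y' M M' : Type*} [Fintype M] [Fintype M'] {n : ℕ}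

/-- Joint law of the messages and of the outputs for uniform messages, when the channel `W` is used
with the encoders `enc` and `enc'`. -/
noncomputable def codeLaw (W : X → X' → Y' → Y → ℝ) (enc : (i : Fin n) → M → (Fin i → Y') → X)
    (enc' : (i : Fin n) → M' → (Fin i → Y) → X') (ω : M × M' × (Fin n → Y') × (Fin n → Y)) : ℝ :=
  (Fintype.card M : ℝ)⁻¹ * (Fintype.card M' : ℝ)⁻¹ *
    ∏ i, W (enc i ω.1 (past ω.2.2.1 i)) (enc' i ω.2.1 (past ω.2.2.2 i)) (ω.2.2.1 i) (ω.2.2.2 i)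

variable {W : X → X' → Y' → Y → ℝ} {enc : (i : Fin n) → M → (Fin i → Y') → X}
  {enc' : (i : Fin n) → M' → (Fin i → Y) → X'}

theorem codeLaw_nonneg (hW : ∀ x x' y' y, 0 ≤ W x x' y' y)
    (ω : M × M' × (Fin n → Y') × (Fin n → Y)) : 0 ≤ codeLaw W enc enc' ω :=
  mul_nonneg (by positivity) (Finset.prod_nonneg fun _ _ => hW _ _ _ _)

variable [Fintype Y] [Fintype Y']

/-- Pairing the two output sequences into one makes the law, for fixed messages, a causal product.
-/
theorem sum_codeLaw_mul (ψ : M → M' → (Fin n → Y' × Y) → ℝ) :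
    ∑ ω : M × M' × (Fin n → Y') × (Fin n → Y),
        codeLaw W enc enc' ω * ψ ω.1 ω.2.1 (fun i => (ω.2.2.1 i, ω.2.2.2 i)) =
      (Fintype.card M : ℝ)⁻¹ * (Fintype.card M' : ℝ)⁻¹ * ∑ m, ∑ m', ∑ z : Fin n → Y' × Y,
        causalProb (fun i h w => W (enc i m fun j => (h j).1) (enc' i m' fun j => (h j).2) w.1 w.2)
          z * ψ m m' z := by
  rw [Fintype.sum_prod_type, Finset.mul_sum]
  refine Finset.sum_congr rfl fun m _ => ?_
  rw [Fintype.sum_prod_type, Finset.mul_sum]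
  refine Finset.sum_congr rfl fun m' _ => ?_
  rw [← (Equiv.arrowProdEquivProdArrow (Fin n) (fun _ => Y') (fun _ => Y)).sum_comp, Finset.mul_sum]
  refine Finset.sum_congr rfl fun z _ => ?_
  rw [← mul_assoc]
  rfl

theorem sum_codeLaw_eq_one [Nonempty M] [Nonempty M'] (hW1 : ∀ x x', ∑ y', ∑ y, W x x' y' y = 1) :
    ∑ ω, codeLaw W enc enc' ω = 1 := by
  have h := sum_codeLaw_mul (W := W) (enc := enc) (enc' := enc') fun _ _ _ => 1
  simp only [mul_one] at h
  rw [h]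
  have hs : ∀ m m', ∑ z : Fin n → Y' × Y, causalProb (fun i h w =>
      W (enc i m fun j => (h j).1) (enc' i m' fun j => (h j).2) w.1 w.2) z = 1 := fun m m' =>
    sum_causalProb_eq_one _ fun i h => by rw [Fintype.sum_prod_type]; exact hW1 _ _
  simp only [hs, Finset.sum_const, Finset.card_univ, nsmul_eq_mul, mul_one]
  field_simp

theorem sum_codeLaw_mul_eq (hW1 : ∀ x x', ∑ y', ∑ y, W x x' y' y = 1) (i : Fin n)
    (φ : X → X' → Y → ℝ) :
    ∑ ω : M × M' × (Fin n → Y') × (Fin n → Y), codeLaw W enc enc' ω *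
        φ (enc i ω.1 (past ω.2.2.1 i)) (enc' i ω.2.1 (past ω.2.2.2 i)) (ω.2.2.2 i) =
      ∑ ω : M × M' × (Fin n → Y') × (Fin n → Y), codeLaw W enc enc' ω *
        ∑ y, (∑ y', W (enc i ω.1 (past ω.2.2.1 i)) (enc' i ω.2.1 (past ω.2.2.2 i)) y' y) *
          φ (enc i ω.1 (past ω.2.2.1 i)) (enc' i ω.2.1 (past ω.2.2.2 i)) y := by
  have h1 := sum_codeLaw_mul (W := W) (enc := enc) (enc' := enc') fun m m' z =>
    φ (enc i m fun j => (past z i j).1) (enc' i m' fun j => (past z i j).2) (z i).2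
  have h2 := sum_codeLaw_mul (W := W) (enc := enc) (enc' := enc') fun m m' z =>
    ∑ y, (∑ y', W (enc i m fun j => (past z i j).1) (enc' i m' fun j => (past z i j).2) y' y) *
      φ (enc i m fun j => (past z i j).1) (enc' i m' fun j => (past z i j).2) y
  refine h1.trans (Eq.trans ?_ h2.symm)
  congr 1
  refine Finset.sum_congr rfl fun m _ => Finset.sum_congr rfl fun m' _ => ?_
  refine (sum_causalProb_mul _ (fun i h => ?_) i
    fun (h : Fin i → Y' × Y) (w : Y' × Y) => φ (enc i m fun j => (h j).1) (enc' i m' fun j => (h j).2) w.2).trans ?_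
  · rw [Fintype.sum_prod_type]; exact hW1 _ _
  · refine Finset.sum_congr rfl fun z _ => ?_
    rw [Fintype.sum_prod_type_right]
    simp only [Finset.sum_mul]

open Classical in
/-- Joint law of the `i`-th inputs. -/
noncomputable def inputLaw (W : X → X' → Y' → Y → ℝ) (enc : (i : Fin n) → M → (Fin i → Y') → X)
    (enc' : (i : Fin n) → M' → (Fin i → Y) → X') (i : Fin n) (x : X) (x' : X') : ℝ :=
  ∑ ω : M × M' × (Fin n → Y') × (Fin n → Y),
    if enc i ω.1 (past ω.2.2.1 i) = x ∧ enc' i ω.2.1 (past ω.2.2.2 i) = x' then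
      codeLaw W enc enc' ω else 0

theorem inputLaw_nonneg (hW : ∀ x x' y' y, 0 ≤ W x x' y' y) (i : Fin n) (x : X) (x' : X') :
    0 ≤ inputLaw W enc enc' i x x' :=
  Finset.sum_nonneg fun ω _ => by split_ifs <;> simp [codeLaw_nonneg hW]

theorem inputLaw_pos (hW : ∀ x x' y' y, 0 ≤ W x x' y' y) (i : Fin n)
    {ω : M × M' × (Fin n → Y') × (Fin n → Y)} (hω : 0 < codeLaw W enc enc' ω) :
    0 < inputLaw W enc enc' i (enc i ω.1 (past ω.2.2.1 i)) (enc' i ω.2.1 (past ω.2.2.2 i)) :=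
  Finset.sum_pos' (fun ω _ => by split_ifs <;> simp [codeLaw_nonneg hW])
    ⟨ω, Finset.mem_univ _, by simpa using hω⟩

/-- The mean information density at time `i` depends on the code only through the joint law of the
`i`-th inputs, since given these the output follows the memoryless channel. -/
theorem sum_codeLaw_mul_log [Fintype X] [Fintype X'] (hW1 : ∀ x x', ∑ y', ∑ y, W x x' y' y = 1) (i : Fin n) :
    ∑ ω : M × M' × (Fin n → Y') × (Fin n → Y), codeLaw W enc enc' ω * Real.logb 2
        ((∑ y', W (enc i ω.1 (past ω.2.2.1 i)) (enc' i ω.2.1 (past ω.2.2.2 i)) y' (ω.2.2.2 i)) /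
          outputGiven (inputLaw W enc enc' i) (fun x x' y => ∑ y', W x x' y' y)
            (enc' i ω.2.1 (past ω.2.2.2 i)) (ω.2.2.2 i)) =
      condMutualInfo fun x y x' => inputLaw W enc enc' i x x' * ∑ y', W x x' y' y := by
  classical
  refine (sum_codeLaw_mul_eq hW1 i fun x x' y => Real.logb 2 ((∑ y', W x x' y' y) /
    outputGiven (inputLaw W enc enc' i) (fun x x' y => ∑ y', W x x' y' y) x' y)).trans ?_
  rw [condMutualInfo_eq_sum_log (P := inputLaw W enc enc' i)
    (V := fun x x' y => ∑ y', W x x' y' y) fun x x' => by rw [Finset.sum_comm]; exact hW1 x x']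
  simp only [mul_assoc, ← Finset.mul_sum]
  refine (sum_indicator_mul (codeLaw W enc enc') (fun ω => enc i ω.1 (past ω.2.2.1 i))
    (fun ω => enc' i ω.2.1 (past ω.2.2.2 i)) fun x x' => ∑ y, (∑ y', W x x' y' y) * Real.logb 2
      ((∑ y', W x x' y' y) / outputGiven (inputLaw W enc enc' i)
        (fun x x' y => ∑ y', W x x' y' y) x' y)).symm.trans ?_
  refine Finset.sum_congr rfl fun x _ => Finset.sum_congr rfl fun x' _ => ?_
  unfold inputLaw
  congr!

theorem outputGiven_nonneg {A B C : Type*} [Fintype A] {P : A → C → ℝ} {V : A → C → B → ℝ}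
    (hP : ∀ a c, 0 ≤ P a c) (hV : ∀ a c b, 0 ≤ V a c b) (c : C) (b : B) :
    0 ≤ outputGiven P V c b :=
  div_nonneg (Finset.sum_nonneg fun a _ => mul_nonneg (hP a c) (hV a c b))
    (Finset.sum_nonneg fun a _ => hP a c)

theorem sum_outputGiven_le_one {A B C : Type*} [Fintype A] [Fintype B] {P : A → C → ℝ}
    {V : A → C → B → ℝ} (hV1 : ∀ a c, ∑ b, V a c b = 1) (c : C) :
    ∑ b, outputGiven P V c b ≤ 1 := by
  unfold outputGiven
  rw [← Finset.sum_div, Finset.sum_comm]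
  simp only [← Finset.mul_sum, hV1, mul_one]
  exact div_self_le_one _

/-- Sum over `y'`, then `m`, then `y`. For fixed `y` the quotients of `W` are causal kernels in
`y'`. The decoding weights then sum to at most `card M` over `m`, because neither `dec` nor the
inputs `enc'` see `m`. What remains is causal in `y`. -/
theorem sum_reference_le_one [Nonempty M] [Nonempty M'] [DecidableEq M]
    (hW : ∀ x x' y' y, 0 ≤ W x x' y' y)
    {Q : Fin n → X' → Y → ℝ} (hQ : ∀ i x' y, 0 ≤ Q i x' y) (hQ1 : ∀ i x', ∑ y, Q i x' y ≤ 1)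
    (dec : M' → (Fin n → Y) → M) :
    ∑ ω : M × M' × (Fin n → Y') × (Fin n → Y),
      (Fintype.card M : ℝ)⁻¹ * (Fintype.card M' : ℝ)⁻¹ *
        (∏ i, Q i (enc' i ω.2.1 (past ω.2.2.2 i)) (ω.2.2.2 i) *
          (W (enc i ω.1 (past ω.2.2.1 i)) (enc' i ω.2.1 (past ω.2.2.2 i)) (ω.2.2.1 i) (ω.2.2.2 i) /
            ∑ y', W (enc i ω.1 (past ω.2.2.1 i)) (enc' i ω.2.1 (past ω.2.2.2 i)) y' (ω.2.2.2 i))) *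
        ((if dec ω.2.1 ω.2.2.2 = ω.1 then (Fintype.card M : ℝ) else 1) / 2) ≤ 1 := by
  have hM : (1 : ℝ) ≤ Fintype.card M := by exact_mod_cast Fintype.card_pos
  set a : ℝ := (Fintype.card M : ℝ) with ha
  set b : ℝ := (Fintype.card M' : ℝ) with hb
  have hb0 : (0 : ℝ) < b := by rw [hb]; exact_mod_cast Fintype.card_pos
  have hV : ∀ m m' y, ∑ y' : Fin n → Y', ∏ i,
      (W (enc i m (past y' i)) (enc' i m' (past y i)) (y' i) (y i) /
        ∑ w, W (enc i m (past y' i)) (enc' i m' (past y i)) w (y i)) ≤ 1 := fun m m' y =>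
    sum_causalProb_le_one (fun i h w => W (enc i m h) (enc' i m' (past y i)) w (y i) /
        ∑ w, W (enc i m h) (enc' i m' (past y i)) w (y i))
      (fun i h w => div_nonneg (hW _ _ _ _) (Finset.sum_nonneg fun _ _ => hW _ _ _ _))
      fun i h => by rw [← Finset.sum_div]; exact div_self_le_one _
  have hQs : ∀ m', ∑ y : Fin n → Y, ∏ i, Q i (enc' i m' (past y i)) (y i) ≤ 1 := fun m' =>
    sum_causalProb_le_one (fun i h w => Q i (enc' i m' h) w) (fun _ _ _ => hQ _ _ _)
      fun _ _ => hQ1 _ _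
  -- One message has weight `a` and the other `a - 1` have weight 1, so the sum is `(2a - 1) / 2`.
  have hg : ∀ (m₀ : M), ∑ m, (if m₀ = m then a else 1) / 2 ≤ a := fun m₀ => by
    rw [← Finset.sum_div, ← Finset.add_sum_erase _ _ (Finset.mem_univ m₀), if_pos rfl,
      Finset.sum_congr rfl (g := fun _ => (1 : ℝ))
        fun m hm => if_neg (Finset.ne_of_mem_erase hm).symm,
      Finset.sum_const, Finset.card_erase_of_mem (Finset.mem_univ _), Finset.card_univ,
      nsmul_eq_mul, mul_one, Nat.cast_sub Fintype.card_pos, ← ha]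
    push_cast
    linarith
  have hstep : ∀ (g : M → M → ℝ), (∀ m₀ m, 0 ≤ g m₀ m) → ∀ m m', ∑ z : (Fin n → Y') × (Fin n → Y), a⁻¹ * b⁻¹ *
        (∏ i, Q i (enc' i m' (past z.2 i)) (z.2 i) *
          (W (enc i m (past z.1 i)) (enc' i m' (past z.2 i)) (z.1 i) (z.2 i) /
            ∑ y', W (enc i m (past z.1 i)) (enc' i m' (past z.2 i)) y' (z.2 i))) *
        g (dec m' z.2) m ≤
      ∑ y : Fin n → Y, a⁻¹ * b⁻¹ * ((∏ i, Q i (enc' i m' (past y i)) (y i)) *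
        g (dec m' y) m) := fun g hg0 m m' => by
    rw [Fintype.sum_prod_type_right]
    refine Finset.sum_le_sum fun y _ => ?_
    simp only [Finset.prod_mul_distrib]
    simp only [← Finset.sum_mul, ← Finset.mul_sum, mul_assoc (a⁻¹ * b⁻¹)]
    refine mul_le_mul_of_nonneg_left (mul_le_mul_of_nonneg_right
      (mul_le_of_le_one_right (Finset.prod_nonneg fun _ _ => hQ _ _ _) (hV m m' y)) (hg0 _ _))
      (by positivity)
  rw [Fintype.sum_prod_type]
  simp only [Fintype.sum_prod_type (α₁ := M')]
  refine (Finset.sum_le_sum fun m _ => Finset.sum_le_sum fun m' _ =>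
    hstep (fun m₀ m => (if m₀ = m then a else 1) / 2)
      (fun _ _ => by split_ifs <;> linarith) m m').trans ?_
  rw [Finset.sum_comm]
  have h2 : ∀ m', ∑ m, ∑ y : Fin n → Y, a⁻¹ * b⁻¹ * ((∏ i, Q i (enc' i m' (past y i)) (y i)) *
        ((if dec m' y = m then a else 1) / 2)) ≤ b⁻¹ := fun m' => by
    rw [Finset.sum_comm]
    simp only [← Finset.mul_sum]
    calc a⁻¹ * b⁻¹ * ∑ y : Fin n → Y, (∏ i, Q i (enc' i m' (past y i)) (y i)) *
          ∑ m, (if dec m' y = m then a else 1) / 2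
        ≤ a⁻¹ * b⁻¹ * ∑ y : Fin n → Y, (∏ i, Q i (enc' i m' (past y i)) (y i)) * a := by
          refine mul_le_mul_of_nonneg_left (Finset.sum_le_sum fun y _ =>
            mul_le_mul_of_nonneg_left (hg _) (Finset.prod_nonneg fun _ _ => hQ _ _ _))
            (by positivity)
      _ = b⁻¹ * ∑ y : Fin n → Y, (∏ i, Q i (enc' i m' (past y i)) (y i)) := by
          rw [← Finset.sum_mul]; field_simp
      _ ≤ b⁻¹ := mul_le_of_le_one_right (by positivity) (hQs m')
  refine (Finset.sum_le_sum fun m' _ => h2 m').trans ?_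
  rw [Finset.sum_const, Finset.card_univ, nsmul_eq_mul, ← hb, mul_inv_cancel₀ hb0.ne']

/-- The number of messages that can be decoded reliably is controlled by the sum of the conditional
mutual informations of the channel uses. -/
theorem prob_correct_mul_log_card_le [Fintype X] [Fintype X'] [Nonempty M] [Nonempty M'] [DecidableEq M]
    (hW : ∀ x x' y' y, 0 ≤ W x x' y' y) (hW1 : ∀ x x', ∑ y', ∑ y, W x x' y' y = 1)
    (dec : M' → (Fin n → Y) → M) :
    (∑ ω, if dec ω.2.1 ω.2.2.2 = ω.1 then codeLaw W enc enc' ω else 0) *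
        Real.logb 2 (Fintype.card M) - 1 ≤
      ∑ i, condMutualInfo fun x y x' => inputLaw W enc enc' i x x' * ∑ y', W x x' y' y := by
  have hM : (0 : ℝ) < Fintype.card M := by exact_mod_cast Fintype.card_pos
  have hM' : (0 : ℝ) < Fintype.card M' := by exact_mod_cast Fintype.card_pos
  set V : X → X' → Y → ℝ := fun x x' y => ∑ y', W x x' y' y with hVdef
  have hV0 : ∀ x x' y, 0 ≤ V x x' y := fun x x' y => Finset.sum_nonneg fun _ _ => hW _ _ _ _
  have hV1 : ∀ x x', ∑ y, V x x' y = 1 := fun x x' => by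
    rw [← hW1 x x', Finset.sum_comm]
  set Q : Fin n → X' → Y → ℝ := fun i => outputGiven (inputLaw W enc enc' i) V with hQdef
  have hP0 := fun i => inputLaw_nonneg (enc := enc) (enc' := enc') hW i
  have hQ0 : ∀ i x' y, 0 ≤ Q i x' y := fun i => outputGiven_nonneg (hP0 i) hV0
  have hQ1 : ∀ i x', ∑ y, Q i x' y ≤ 1 := fun i => sum_outputGiven_le_one hV1
  have href := sum_reference_le_one (enc := enc) (enc' := enc') hW hQ0 hQ1 dec
  -- Reference measure: `y` is drawn from `Q i` given `x'` alone, while the law of `y'` given both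
  -- inputs and `y` is kept. The value 1 on wrong decoding keeps `r` positive wherever the code law
  -- is; the factor 1/2 compensates for it and becomes the bit lost in the conclusion.
  set r : M × M' × (Fin n → Y') × (Fin n → Y) → ℝ := fun ω =>
    (Fintype.card M : ℝ)⁻¹ * (Fintype.card M' : ℝ)⁻¹ *
        (∏ i, Q i (enc' i ω.2.1 (past ω.2.2.2 i)) (ω.2.2.2 i) *
          (W (enc i ω.1 (past ω.2.2.1 i)) (enc' i ω.2.1 (past ω.2.2.2 i)) (ω.2.2.1 i) (ω.2.2.2 i) /
            V (enc i ω.1 (past ω.2.2.1 i)) (enc' i ω.2.1 (past ω.2.2.2 i)) (ω.2.2.2 i))) *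
        ((if dec ω.2.1 ω.2.2.2 = ω.1 then (Fintype.card M : ℝ) else 1) / 2) with hr
  have hr0 : ∀ ω, 0 ≤ r ω := fun ω => by
    refine mul_nonneg (mul_nonneg (by positivity) (Finset.prod_nonneg fun _ _ =>
      mul_nonneg (hQ0 _ _ _) (div_nonneg (hW _ _ _ _) (hV0 _ _ _)))) ?_
    split_ifs <;> positivity
  have hpt : ∀ ω, (codeLaw W enc enc' ω - r ω) / Real.log 2 ≤ codeLaw W enc enc' ω *
      (∑ i, Real.logb 2 (V (enc i ω.1 (past ω.2.2.1 i)) (enc' i ω.2.1 (past ω.2.2.2 i))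
          (ω.2.2.2 i) / Q i (enc' i ω.2.1 (past ω.2.2.2 i)) (ω.2.2.2 i)) + 1 -
        (if dec ω.2.1 ω.2.2.2 = ω.1 then Real.logb 2 (Fintype.card M) else 0)) := fun ω => by
    refine le_mul_logb_of_pos (codeLaw_nonneg hW ω) (hr0 ω) fun hp => ?_
    have hWpos : ∀ i, 0 < W (enc i ω.1 (past ω.2.2.1 i)) (enc' i ω.2.1 (past ω.2.2.2 i))
        (ω.2.2.1 i) (ω.2.2.2 i) := fun i => by
      refine lt_of_le_of_ne (hW _ _ _ _) fun h => hp.ne' ?_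
      exact mul_eq_zero_of_right _ (Finset.prod_eq_zero (Finset.mem_univ i) h.symm)
    have hVpos : ∀ i, 0 < V (enc i ω.1 (past ω.2.2.1 i)) (enc' i ω.2.1 (past ω.2.2.2 i))
        (ω.2.2.2 i) := fun i =>
      sum_pos_of_mem_support (fun _ => hW _ _ _ _) (hWpos i).ne'
    have hQpos : ∀ i, 0 < Q i (enc' i ω.2.1 (past ω.2.2.2 i)) (ω.2.2.2 i) := fun i =>
      outputGiven_pos (hP0 i) hV0 (inputLaw_pos hW i hp).ne' (hVpos i).ne'
    have hg : (0 : ℝ) < (if dec ω.2.1 ω.2.2.2 = ω.1 then (Fintype.card M : ℝ) else 1) / 2 := by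
      split_ifs <;> positivity
    refine ⟨mul_pos (mul_pos (by positivity) (Finset.prod_pos fun i _ =>
      mul_pos (hQpos i) (div_pos (hWpos i) (hVpos i)))) hg, ?_⟩
    have hquot : codeLaw W enc enc' ω / r ω =
        (∏ i, (V (enc i ω.1 (past ω.2.2.1 i)) (enc' i ω.2.1 (past ω.2.2.2 i))
          (ω.2.2.2 i) / Q i (enc' i ω.2.1 (past ω.2.2.2 i)) (ω.2.2.2 i))) /
        ((if dec ω.2.1 ω.2.2.2 = ω.1 then (Fintype.card M : ℝ) else 1) / 2) := by
      rw [hr, codeLaw]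
      simp only
      rw [← div_div, mul_div_mul_left _ _ (by positivity), ← Finset.prod_div_distrib]
      congr 1
      refine Finset.prod_congr rfl fun i _ => ?_
      have := (hWpos i).ne'
      have := (hVpos i).ne'
      have := (hQpos i).ne'
      field_simp
    rw [hquot, Real.logb_div (Finset.prod_pos fun i _ => div_pos (hVpos i) (hQpos i)).ne' hg.ne',
      Real.logb_prod _ _ fun i _ => (div_pos (hVpos i) (hQpos i)).ne']
    split_ifs
    · rw [Real.logb_div hM.ne' two_ne_zero, Real.logb_self_eq_one one_lt_two]; ring
    · rw [Real.logb_div one_ne_zero two_ne_zero, Real.logb_self_eq_one one_lt_two, Real.logb_one]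
      ring
  have hsum := Finset.sum_le_sum fun ω (_ : ω ∈ Finset.univ) => hpt ω
  rw [← Finset.sum_div, Finset.sum_sub_distrib, sum_codeLaw_eq_one hW1] at hsum
  -- The code law has mass one and `r` at most one, so the summed lower bound is nonnegative.
  have h0 := (div_nonneg (sub_nonneg.2 href) (Real.log_pos one_lt_two).le).trans hsum
  simp only [mul_sub, mul_add, mul_one, Finset.sum_sub_distrib, Finset.sum_add_distrib,
    sum_codeLaw_eq_one hW1, Finset.mul_sum] at h0
  rw [Finset.sum_comm] at h0
  have hE := fun i => sum_codeLaw_mul_log (enc := enc) (enc' := enc') hW1 i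
  simp only [hQdef, hVdef] at h0
  simp only [hE, mul_ite, mul_zero] at h0
  simp only [Finset.sum_mul, ite_mul, zero_mul]
  linarith

end Converse

-- Time averaging and message counts.

theorem condMutualInfo_nonneg {A B C : Type*} [Fintype A] [Fintype B] [Fintype C]
    {P : A → C → ℝ} {V : A → C → B → ℝ} (hP : ∀ a c, 0 ≤ P a c) (hV : ∀ a c b, 0 ≤ V a c b)
    (hV1 : ∀ a c, ∑ b, V a c b = 1) :
    0 ≤ condMutualInfo (fun a b c => P a c * V a c b) := by
  rw [condMutualInfo_eq_sum_log hV1]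
  refine Finset.sum_nonneg fun a _ => Finset.sum_nonneg fun c _ => ?_
  have hpt : ∀ b, (P a c * V a c b - P a c * outputGiven P V c b) / Real.log 2 ≤
      P a c * V a c b * Real.logb 2 (V a c b / outputGiven P V c b) := fun b => by
    refine le_mul_logb_of_pos (mul_nonneg (hP _ _) (hV _ _ _))
      (mul_nonneg (hP _ _) (outputGiven_nonneg hP hV c b)) fun h => ?_
    have h1 : P a c ≠ 0 := left_ne_zero_of_mul h.ne'
    have h2 : V a c b ≠ 0 := right_ne_zero_of_mul h.ne'
    have hQ := outputGiven_pos hP hV h1 h2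
    exact ⟨mul_pos ((hP _ _).lt_of_ne h1.symm) hQ, by rw [mul_div_mul_left _ _ h1]⟩
  refine le_trans ?_ (Finset.sum_le_sum fun b _ => hpt b)
  rw [← Finset.sum_div, Finset.sum_sub_distrib, ← Finset.mul_sum, ← Finset.mul_sum, hV1]
  refine div_nonneg (sub_nonneg.2 ?_) (Real.log_pos one_lt_two).le
  exact mul_le_mul_of_nonneg_left (sum_outputGiven_le_one hV1 c) (hP a c)

/-- All `α i` are shrunk by the common factor `n * a / ∑ α`; if the sum vanishes then `a = 0`. -/
theorem exists_scaling {n : ℕ} (hn : 0 < n) {α : Fin n → ℝ} (hα : ∀ i, 0 ≤ α i) {a : ℝ}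
    (ha : 0 ≤ a) (h : n * a ≤ ∑ i, α i) :
    ∃ s : Fin n → ℝ, (∀ i, 0 ≤ s i ∧ s i ≤ α i) ∧ ∑ i, (n : ℝ)⁻¹ * s i = a := by
  have hn' : (0 : ℝ) < n := by exact_mod_cast hn
  rcases (Finset.sum_nonneg fun i (_ : i ∈ Finset.univ) => hα i).eq_or_lt with h0 | h0
  · refine ⟨fun _ => 0, fun i => ⟨le_rfl, hα i⟩, ?_⟩
    rw [← h0] at h
    have : a = 0 := le_antisymm (nonpos_of_mul_nonpos_right h hn') ha
    simp [this]
  · refine ⟨fun i => (n * a / ∑ i, α i) * α i, fun i => ⟨?_, ?_⟩, ?_⟩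
    · exact mul_nonneg (div_nonneg (by positivity) h0.le) (hα i)
    · exact mul_le_of_le_one_left (hα i) ((div_le_one h0).2 h)
    · rw [← Finset.mul_sum, ← Finset.mul_sum]
      field_simp

/-- `S` contains whole rectangles, so the two coordinates can be shrunk independently until their
averages are exactly `a` and `b`. -/
theorem mem_convexHull_of_le_average {S : Set (ℝ × ℝ)} {n : ℕ} (hn : 0 < n) {α β : Fin n → ℝ}
    (hα : ∀ i, 0 ≤ α i) (hβ : ∀ i, 0 ≤ β i)
    (hS : ∀ i s t, 0 ≤ s → 0 ≤ t → s ≤ α i → t ≤ β i → (s, t) ∈ S) {a b : ℝ} (ha : 0 ≤ a)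
    (hb : 0 ≤ b) (haα : n * a ≤ ∑ i, α i) (hbβ : n * b ≤ ∑ i, β i) :
    (a, b) ∈ convexHull ℝ S := by
  obtain ⟨s, hs, rfl⟩ := exists_scaling hn hα ha haα
  obtain ⟨t, ht, rfl⟩ := exists_scaling hn hβ hb hbβ
  have hn' : (n : ℝ) ≠ 0 := by exact_mod_cast hn.ne'
  have := (convex_convexHull ℝ S).sum_mem (t := Finset.univ) (w := fun _ : Fin n => (n : ℝ)⁻¹)
    (z := fun i => (s i, t i)) (fun _ _ => by positivity) (by simp [hn'])
    fun i _ => subset_convexHull ℝ S (hS i _ _ (hs i).1 (ht i).1 (hs i).2 (ht i).2)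
  convert this using 1
  ext <;> simp [Prod.fst_sum, Prod.snd_sum]

theorem one_le_two_rpow_mul (n : ℕ) {R : ℝ} (hR : 0 ≤ R) : (1 : ℝ) ≤ (2 : ℝ) ^ ((n : ℝ) * R) :=
  Real.one_le_rpow one_le_two (by positivity)

theorem numMessages_pos (n : ℕ) {R : ℝ} (hR : 0 ≤ R) : 0 < numMessages n R :=
  Nat.floor_pos.2 (one_le_two_rpow_mul n hR)

theorem sub_one_le_logb_numMessages (n : ℕ) {R : ℝ} (hR : 0 ≤ R) :
    n * R - 1 ≤ Real.logb 2 (numMessages n R) := by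
  -- Rounding down costs at most one bit, since `M + 1 ≤ 2 * M` for `M ≥ 1`.
  have h1 : (2 : ℝ) ^ ((n : ℝ) * R) < numMessages n R + 1 := Nat.lt_floor_add_one _
  have h2 : (1 : ℝ) ≤ numMessages n R := by exact_mod_cast numMessages_pos n hR
  rw [Real.le_logb_iff_rpow_le one_lt_two (by linarith), Real.rpow_sub two_pos, Real.rpow_one]
  linarith

-- The converse bound for both users of a two-way code.

section

variable {X₁ X₂ Y₁ Y₂ : Type*} [Fintype Y₁] [Fintype Y₂] {n : ℕ} {R₁ R₂ : ℝ}

/-- The exchange of the two users on messages and outputs. -/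
def swapOutcome (M₁ M₂ A₁ A₂ : Type*) : M₁ × M₂ × A₁ × A₂ ≃ M₂ × M₁ × A₂ × A₁ where
  toFun ω := (ω.2.1, ω.1, ω.2.2.2, ω.2.2.1)
  invFun ω := (ω.2.1, ω.1, ω.2.2.2, ω.2.2.1)
  left_inv _ := rfl
  right_inv _ := rfl

variable (c : Code X₁ X₂ Y₁ Y₂ n R₁ R₂) (W : Channel X₁ X₂ Y₁ Y₂)

/-- Joint law of the messages and outputs of a code. -/
noncomputable def Code.law (ω : Fin (numMessages n R₁) × Fin (numMessages n R₂) ×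
    (Fin n → Y₁) × (Fin n → Y₂)) : ℝ :=
  codeLaw (fun x₁ x₂ y₁ y₂ => (W x₁ x₂).1 (y₁, y₂)) c.enc₁ c.enc₂ ω

theorem Code.law_swap (ω : Fin (numMessages n R₁) × Fin (numMessages n R₂) ×
    (Fin n → Y₁) × (Fin n → Y₂)) :
    codeLaw (fun x₂ x₁ y₂ y₁ => (W x₁ x₂).1 (y₁, y₂)) c.enc₂ c.enc₁ (swapOutcome _ _ _ _ ω) =
      c.law W ω := by
  unfold Code.law codeLaw
  rw [mul_comm (Fintype.card (Fin (numMessages n R₁)) : ℝ)⁻¹]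
  rfl

theorem Code.errorProb_eq : c.errorProb W =
    ∑ ω, if c.dec₂ ω.2.1 ω.2.2.2 ≠ ω.1 ∨ c.dec₁ ω.1 ω.2.2.1 ≠ ω.2.1 then c.law W ω else 0 := by
  simp only [Fintype.sum_prod_type]
  unfold Code.errorProb
  refine Finset.sum_congr rfl fun m₁ _ => Finset.sum_congr rfl fun m₂ _ => ?_
  simp only [Finset.mul_sum]
  refine Finset.sum_congr rfl fun y₁ _ => Finset.sum_congr rfl fun y₂ _ => ?_
  rw [mul_ite, mul_zero]
  refine if_congr Iff.rfl ?_ rfl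
  simp only [Code.law, codeLaw, Code.outputProb, Fintype.card_fin]

theorem Code.law_nonneg (ω) : 0 ≤ c.law W ω := codeLaw_nonneg (fun _ _ _ _ => (W _ _).2.1 _) ω

theorem sum_channel (W : Channel X₁ X₂ Y₁ Y₂) (x₁ : X₁) (x₂ : X₂) :
    ∑ y₁, ∑ y₂, (W x₁ x₂).1 (y₁, y₂) = 1 := by
  rw [← Fintype.sum_prod_type', (W x₁ x₂).2.2]

theorem Code.sum_law (h₁ : 0 ≤ R₁) (h₂ : 0 ≤ R₂) : ∑ ω, c.law W ω = 1 := by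
  have : Nonempty (Fin (numMessages n R₁)) := ⟨⟨0, numMessages_pos n h₁⟩⟩
  have : Nonempty (Fin (numMessages n R₂)) := ⟨⟨0, numMessages_pos n h₂⟩⟩
  exact sum_codeLaw_eq_one (sum_channel W)

theorem inputLaw_swap (i : Fin n) (x₁ : X₁) (x₂ : X₂) :
    inputLaw (fun x₂ x₁ y₂ y₁ => (W x₁ x₂).1 (y₁, y₂)) c.enc₂ c.enc₁ i x₂ x₁ =
      inputLaw (fun x₁ x₂ y₁ y₂ => (W x₁ x₂).1 (y₁, y₂)) c.enc₁ c.enc₂ i x₁ x₂ := by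
  unfold inputLaw
  rw [← (swapOutcome _ _ _ _).sum_comp]
  refine Finset.sum_congr rfl fun ω _ => ?_
  rw [Code.law_swap]
  congr 1
  exact propext and_comm

variable [Fintype X₁] [Fintype X₂]

/-- Joint law of the inputs of the two users at time `i`. -/
noncomputable def Code.inputDist (h₁ : 0 ≤ R₁) (h₂ : 0 ≤ R₂) (i : Fin n) : ProbDist (X₁ × X₂) :=
  ⟨fun x => inputLaw (fun x₁ x₂ y₁ y₂ => (W x₁ x₂).1 (y₁, y₂)) c.enc₁ c.enc₂ i x.1 x.2,
    fun _ => inputLaw_nonneg (fun _ _ _ _ => (W _ _).2.1 _) _ _ _, by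
    classical
    rw [Fintype.sum_prod_type]
    have := sum_indicator_mul (c.law W) (fun ω => c.enc₁ i ω.1 (past ω.2.2.1 i))
      (fun ω => c.enc₂ i ω.2.1 (past ω.2.2.2 i)) fun _ _ => 1
    simp only [mul_one, c.sum_law W h₁ h₂] at this
    rw [← this]
    refine Finset.sum_congr rfl fun x _ => Finset.sum_congr rfl fun x' _ => ?_
    unfold inputLaw Code.law
    congr!⟩

theorem Code.one_sub_errorProb_mul_le₁ (h₁ : 0 ≤ R₁) (h₂ : 0 ≤ R₂) (hc : c.errorProb W ≤ 1) :
    (1 - c.errorProb W) * (n * R₁ - 1) - 1 ≤ ∑ i, infoX1Y2 (c.inputDist W h₁ h₂ i) W := by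
  have : Nonempty (Fin (numMessages n R₁)) := ⟨⟨0, numMessages_pos n h₁⟩⟩
  have : Nonempty (Fin (numMessages n R₂)) := ⟨⟨0, numMessages_pos n h₂⟩⟩
  have key := prob_correct_mul_log_card_le (enc := c.enc₁) (enc' := c.enc₂)
    (W := fun x₁ x₂ y₁ y₂ => (W x₁ x₂).1 (y₁, y₂)) (fun _ _ _ _ => (W _ _).2.1 _)
    (sum_channel W) c.dec₂
  refine le_trans (sub_le_sub_right ?_ _) key
  rw [Fintype.card_fin]
  have hpc : 1 - c.errorProb W ≤ ∑ ω, if c.dec₂ ω.2.1 ω.2.2.2 = ω.1 then c.law W ω else 0 := by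
    rw [sub_le_iff_le_add, ← c.sum_law W h₁ h₂, c.errorProb_eq, ← Finset.sum_add_distrib]
    refine Finset.sum_le_sum fun ω _ => ?_
    have := c.law_nonneg W ω
    by_cases h : c.dec₂ ω.2.1 ω.2.2.2 = ω.1
    · rw [if_pos h]; split_ifs <;> linarith
    · rw [if_neg h, if_pos (Or.inl h), zero_add]
  exact (mul_le_mul_of_nonneg_left (sub_one_le_logb_numMessages n h₁) (sub_nonneg.2 hc)).trans
    (mul_le_mul_of_nonneg_right hpc (Real.logb_nonneg one_lt_two
      (by exact_mod_cast numMessages_pos n h₁)))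

theorem Code.one_sub_errorProb_mul_le₂ (h₁ : 0 ≤ R₁) (h₂ : 0 ≤ R₂) (hc : c.errorProb W ≤ 1) :
    (1 - c.errorProb W) * (n * R₂ - 1) - 1 ≤ ∑ i, infoX2Y1 (c.inputDist W h₁ h₂ i) W := by
  have : Nonempty (Fin (numMessages n R₁)) := ⟨⟨0, numMessages_pos n h₁⟩⟩
  have : Nonempty (Fin (numMessages n R₂)) := ⟨⟨0, numMessages_pos n h₂⟩⟩
  have key := prob_correct_mul_log_card_le (enc := c.enc₂) (enc' := c.enc₁)
    (W := fun x₂ x₁ y₂ y₁ => (W x₁ x₂).1 (y₁, y₂)) (fun _ _ _ _ => (W _ _).2.1 _)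
    (fun x₂ x₁ => by rw [Finset.sum_comm]; exact sum_channel W x₁ x₂) c.dec₁
  simp only [inputLaw_swap] at key
  refine le_trans (sub_le_sub_right ?_ _) key
  rw [Fintype.card_fin, ← (swapOutcome _ _ _ _).sum_comp]
  simp only [Code.law_swap]
  have hpc : 1 - c.errorProb W ≤ ∑ ω, if c.dec₁ ω.1 ω.2.2.1 = ω.2.1 then c.law W ω else 0 := by
    rw [sub_le_iff_le_add, ← c.sum_law W h₁ h₂, c.errorProb_eq, ← Finset.sum_add_distrib]
    refine Finset.sum_le_sum fun ω _ => ?_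
    have := c.law_nonneg W ω
    by_cases h : c.dec₁ ω.1 ω.2.2.1 = ω.2.1
    · rw [if_pos h]; split_ifs <;> linarith
    · rw [if_neg h, if_pos (Or.inr h), zero_add]
  exact (mul_le_mul_of_nonneg_left (sub_one_le_logb_numMessages n h₂) (sub_nonneg.2 hc)).trans
    (mul_le_mul_of_nonneg_right hpc (Real.logb_nonneg one_lt_two
      (by exact_mod_cast numMessages_pos n h₂)))

end

-- The outer bound.

section

variable {X₁ X₂ Y₁ Y₂ : Type*} [Fintype X₁] [Fintype X₂] [Fintype Y₁] [Fintype Y₂]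

theorem infoX1Y2_nonneg (P : ProbDist (X₁ × X₂)) (W : Channel X₁ X₂ Y₁ Y₂) : 0 ≤ infoX1Y2 P W :=
  condMutualInfo_nonneg (P := fun x₁ x₂ => P.1 (x₁, x₂)) (V := fun x₁ x₂ y => W.toUser2 x₁ x₂ y)
    (fun _ _ => P.2.1 _) (fun _ _ _ => W.toUser2_nonneg _ _ _) fun _ _ => W.sum_toUser2 _ _

theorem infoX2Y1_nonneg (P : ProbDist (X₁ × X₂)) (W : Channel X₁ X₂ Y₁ Y₂) : 0 ≤ infoX2Y1 P W :=
  condMutualInfo_nonneg (P := fun x₂ x₁ => P.1 (x₁, x₂)) (V := fun x₂ x₁ y => W.toUser1 x₁ x₂ y)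
    (fun _ _ => P.2.1 _) (fun _ _ _ => W.toUser1_nonneg _ _ _) fun _ _ => W.sum_toUser1 _ _

-- Clipping at zero keeps the approximating rates nonnegative, as membership in a rate region
-- requires; the limit `R ≥ 0` is unaffected.
open Filter Topology in
theorem tendsto_fano_rate {e : ℕ → ℝ} (he : Tendsto e atTop (𝓝 0)) {R : ℝ} (hR : 0 ≤ R) :
    Tendsto (fun n : ℕ => max 0 (((1 - e n) * (n * R - 1) - 1) / n)) atTop (𝓝 R) := by
  have hinv : Tendsto (fun n : ℕ => ((n : ℝ))⁻¹) atTop (𝓝 0) := tendsto_inv_atTop_nhds_zero_nat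
  have h : Tendsto (fun n : ℕ => max 0 ((1 - e n) * (R - (n : ℝ)⁻¹) - (n : ℝ)⁻¹)) atTop
      (𝓝 (max 0 ((1 - 0) * (R - 0) - 0))) :=
    tendsto_const_nhds.max (((tendsto_const_nhds.sub he).mul (tendsto_const_nhds.sub hinv)).sub hinv)
  rw [sub_zero, sub_zero, sub_zero, one_mul, max_eq_right hR] at h
  refine h.congr' ?_
  filter_upwards [eventually_gt_atTop 0] with n hn
  have hn' : (n : ℝ) ≠ 0 := by exact_mod_cast hn.ne'
  congr 1
  field_simp

open Filter Topology in
theorem Achievable.mem_outerBound {W : Channel X₁ X₂ Y₁ Y₂} {R : ℝ × ℝ} (h : Achievable W R) :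
    R ∈ outerBound W := by
  obtain ⟨h₁, h₂, c, hc⟩ := h
  refine mem_closure_of_tendsto ((tendsto_fano_rate hc h₁).prodMk_nhds (tendsto_fano_rate hc h₂)) ?_
  filter_upwards [eventually_gt_atTop 0, hc.eventually_le_const one_pos] with n hn hc1
  have hn' : (0 : ℝ) < n := by exact_mod_cast hn
  have hα := fun i => infoX1Y2_nonneg ((c n).inputDist W h₁ h₂ i) W
  have hβ := fun i => infoX2Y1_nonneg ((c n).inputDist W h₁ h₂ i) W
  refine mem_convexHull_of_le_average hn hα hβ (fun i s t hs ht hs' ht' => ?_)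
    (le_max_left _ _) (le_max_left _ _) ?_ ?_
  · exact Set.mem_iUnion.2 ⟨_, hs, ht, hs', ht'⟩
  · rw [mul_max_of_nonneg _ _ hn'.le, mul_zero, mul_div_cancel₀ _ hn'.ne']
    exact max_le (Finset.sum_nonneg fun i _ => hα i) ((c n).one_sub_errorProb_mul_le₁ W h₁ h₂ hc1)
  · rw [mul_max_of_nonneg _ _ hn'.le, mul_zero, mul_div_cancel₀ _ hn'.ne']
    exact max_le (Finset.sum_nonneg fun i _ => hβ i) ((c n).one_sub_errorProb_mul_le₂ W h₁ h₂ hc1)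

theorem capacityRegion_subset_outerBound (W : Channel X₁ X₂ Y₁ Y₂) :
    capacityRegion W ⊆ outerBound W :=
  coBar_subset_coBar fun _ hR => Achievable.mem_outerBound hR

end

-- Moments and tails of i.i.d. sequences.

section IID

variable {ι A : Type*} [Fintype ι] [DecidableEq ι] [Fintype A]

theorem sum_prod_eq_prod_sum (f : ι → A → ℝ) :
    ∑ C : ι → A, ∏ k, f k (C k) = ∏ k, ∑ a, f k a := by
  rw [Finset.prod_univ_sum, Fintype.piFinset_univ]

theorem sum_prod_eq_one {p : A → ℝ} (hp1 : ∑ a, p a = 1) : ∑ C : ι → A, ∏ k, p (C k) = 1 := by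
  rw [sum_prod_eq_prod_sum fun _ => p]
  simp [hp1]

theorem sum_prod_mul_eval {p : A → ℝ} (hp1 : ∑ a, p a = 1) (k : ι) (u : A → ℝ) :
    ∑ C : ι → A, (∏ j, p (C j)) * u (C k) = ∑ a, p a * u a := by
  have h := sum_prod_eq_prod_sum fun (j : ι) a => p a * if j = k then u a else 1
  simp only [Finset.prod_mul_distrib, Finset.prod_ite_eq', Finset.mem_univ, if_true] at h
  rw [h, ← Finset.mul_prod_erase _ _ (Finset.mem_univ k), Finset.prod_eq_one]
  · simp
  · intro j hj
    simp [Finset.ne_of_mem_erase hj, hp1]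

theorem sum_prod_mul_eval_mul_eval {p : A → ℝ} (hp1 : ∑ a, p a = 1) {k l : ι} (hkl : k ≠ l)
    (u v : A → ℝ) : ∑ C : ι → A, (∏ j, p (C j)) * (u (C k) * v (C l)) =
      (∑ a, p a * u a) * ∑ a, p a * v a := by
  have h := sum_prod_eq_prod_sum fun (j : ι) a =>
    p a * ((if j = k then u a else 1) * if j = l then v a else 1)
  simp only [Finset.prod_mul_distrib, Finset.prod_ite_eq', Finset.mem_univ, if_true] at h
  rw [h, ← Finset.mul_prod_erase _ _ (Finset.mem_univ k),
    ← Finset.mul_prod_erase _ _ (Finset.mem_erase.2 ⟨hkl.symm, Finset.mem_univ l⟩),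
    Finset.prod_eq_one]
  · simp [hkl, hkl.symm]
  · intro j hj
    have hj' := Finset.mem_erase.1 hj
    simp [hj'.1, Finset.ne_of_mem_erase hj'.2, hp1]

theorem sum_prod_mul_eval₂ {p : A → ℝ} (hp1 : ∑ a, p a = 1) {k l : ι} (hkl : k ≠ l)
    (u : A → A → ℝ) : ∑ C : ι → A, (∏ j, p (C j)) * u (C k) (C l) =
      ∑ a, p a * ∑ b, p b * u a b := by
  classical
  have h : ∀ C : ι → A, (∏ j, p (C j)) * u (C k) (C l) =
      ∑ a, (∏ j, p (C j)) * ((if C k = a then 1 else 0) * u a (C l)) := fun C => by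
    simp
  rw [Finset.sum_congr rfl fun C _ => h C, Finset.sum_comm]
  refine Finset.sum_congr rfl fun a _ => ?_
  rw [sum_prod_mul_eval_mul_eval hp1 hkl (fun b => if b = a then 1 else 0) (u a)]
  simp

/-- Cross terms vanish by independence and centring. -/
theorem sum_prod_mul_sq {p : A → ℝ} (hp1 : ∑ a, p a = 1) {ψ : A → ℝ} (hψ : ∑ a, p a * ψ a = 0) :
    ∑ C : ι → A, (∏ j, p (C j)) * (∑ j, ψ (C j)) ^ 2 = Fintype.card ι * ∑ a, p a * ψ a ^ 2 := by
  have hsq : ∀ C : ι → A, (∑ j, ψ (C j)) ^ 2 = ∑ k, ∑ l, ψ (C k) * ψ (C l) := fun C => by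
    rw [sq, Finset.sum_mul_sum]
  simp only [hsq, Finset.mul_sum (Finset.univ : Finset ι), sq]
  rw [Finset.sum_comm]
  have h : ∀ k, ∑ C : ι → A, ∑ l, (∏ j, p (C j)) * (ψ (C k) * ψ (C l)) =
      ∑ a, p a * (ψ a * ψ a) := fun k => by
    rw [Finset.sum_comm, Finset.sum_eq_single k]
    · exact sum_prod_mul_eval hp1 k fun a => ψ a * ψ a
    · intro l _ hl
      rw [sum_prod_mul_eval_mul_eval hp1 hl.symm, hψ, zero_mul]
    · simp
  rw [Finset.sum_congr rfl fun k _ => h k, Finset.sum_const, Finset.card_univ, nsmul_eq_mul]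

-- Chebyshev: the sum falls short of its mean by at least `n (μ - t)`, while its variance is linear
-- in `n`.
open Classical in
theorem sum_prod_tail_le [Nonempty ι] {p : A → ℝ} (hp : ∀ a, 0 ≤ p a) (hp1 : ∑ a, p a = 1)
    (φ : A → ℝ) {t : ℝ} (ht : t < ∑ a, p a * φ a) :
    ∑ C : ι → A, (if ∑ j, φ (C j) ≤ Fintype.card ι * t then ∏ j, p (C j) else 0) ≤
      (∑ a, p a * (φ a - ∑ b, p b * φ b) ^ 2) / (∑ a, p a * φ a - t) ^ 2 *
        (Fintype.card ι : ℝ)⁻¹ := by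
  set μ := ∑ a, p a * φ a with hμ
  have hn : (0 : ℝ) < Fintype.card ι := by exact_mod_cast Fintype.card_pos
  have hψ : ∑ a, p a * (φ a - μ) = 0 := by
    simp only [mul_sub, Finset.sum_sub_distrib, ← Finset.sum_mul, hp1, one_mul, ← hμ, sub_self]
  have hv := sum_prod_mul_sq (ι := ι) hp1 hψ
  have hδ : 0 < Fintype.card ι * (μ - t) := mul_pos hn (sub_pos.2 ht)
  calc _ ≤ ∑ C : ι → A, (∏ j, p (C j)) * (∑ j, (φ (C j) - μ)) ^ 2 /
          (Fintype.card ι * (μ - t)) ^ 2 := by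
        refine Finset.sum_le_sum fun C _ => ?_
        have h0 : 0 ≤ ∏ j, p (C j) := Finset.prod_nonneg fun _ _ => hp _
        split_ifs with h
        · rw [le_div_iff₀ (by positivity)]
          refine mul_le_mul_of_nonneg_left ?_ h0
          rw [sq_le_sq, abs_of_pos hδ, Finset.sum_sub_distrib, Finset.sum_const, Finset.card_univ,
            nsmul_eq_mul]
          exact le_trans (by linarith) (neg_le_abs _)
        · positivity
    _ = _ := by
        rw [← Finset.sum_div, hv]
        have : μ - t ≠ 0 := (sub_pos.2 ht).ne'
        field_simp

end IID

-- Random coding for a single use of a general channel.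

section OneShot

variable {A B D ι : Type*} [Fintype A] [Fintype ι]

open Classical in
/-- Threshold decoding: look for a codeword `C m` whose likelihood exceeds `θ` times the output
probability. -/
noncomputable def thresholdDecoder [Nonempty ι] (p : A → ℝ) (V : A → B → D → ℝ) (θ : ℝ)
    (C : ι → A) (b : B) (d : D) : ι :=
  if h : ∃ m, θ * ∑ a, p a * V a b d < V (C m) b d then h.choose else Classical.arbitrary ι

-- If the true codeword passes the test, some index is chosen that passes it; an error then exhibits
-- a wrong codeword passing.
open Classical in
theorem thresholdDecoder_error_le [DecidableEq ι] [Nonempty ι] (p : A → ℝ) (V : A → B → D → ℝ) (θ : ℝ)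
    (C : ι → A) (m : ι) (b : B) (d : D) :
    (if thresholdDecoder p V θ C b d ≠ m then (1 : ℝ) else 0) ≤
      (if V (C m) b d ≤ θ * ∑ a, p a * V a b d then 1 else 0) +
        ∑ l ∈ Finset.univ.erase m, if θ * ∑ a, p a * V a b d < V (C l) b d then 1 else 0 := by
  have h0 : ∀ l ∈ Finset.univ.erase m,
      (0 : ℝ) ≤ if θ * ∑ a, p a * V a b d < V (C l) b d then 1 else 0 := fun l _ => by
    split_ifs <;> norm_num
  by_cases hm : V (C m) b d ≤ θ * ∑ a, p a * V a b d
  · rw [if_pos hm]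
    have := Finset.sum_nonneg h0
    split_ifs <;> linarith
  rw [if_neg hm, zero_add]
  split_ifs with he
  · have hex : ∃ m, θ * ∑ a, p a * V a b d < V (C m) b d := ⟨m, not_le.1 hm⟩
    have hch : thresholdDecoder p V θ C b d = hex.choose := dif_pos hex
    rw [hch] at he
    have := Finset.single_le_sum h0 (Finset.mem_erase.2 ⟨he, Finset.mem_univ _⟩)
    rwa [if_pos hex.choose_spec] at this
  · exact Finset.sum_nonneg h0

variable [Fintype D]

open Classical in
/-- Average over random codebooks of the error probability of the threshold decoder. -/
theorem sum_codebook_error_le [DecidableEq ι] [Nonempty ι] {p : A → ℝ} (hp : ∀ a, 0 ≤ p a) (hp1 : ∑ a, p a = 1)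
    {V : A → B → D → ℝ} (hV : ∀ a b d, 0 ≤ V a b d) (hV1 : ∀ a b, ∑ d, V a b d = 1) {θ : ℝ}
    (hθ : 0 < θ) (m : ι) (b : B) :
    ∑ C : ι → A, (∏ k, p (C k)) *
        ∑ d, V (C m) b d * (if thresholdDecoder p V θ C b d ≠ m then 1 else 0) ≤
      (∑ a, p a * ∑ d, V a b d * if V a b d ≤ θ * ∑ a, p a * V a b d then 1 else 0) +
        (Fintype.card ι - 1) * θ⁻¹ := by
  have hw : ∀ C : ι → A, 0 ≤ ∏ k, p (C k) := fun C => Finset.prod_nonneg fun _ _ => hp _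
  -- A wrong codeword is independent of the output. Averaging over the true one leaves the output
  -- law `∑ p V`, which on the test event is below `θ⁻¹` times the likelihood of the wrong codeword.
  have hpair : ∀ l ∈ Finset.univ.erase m, ∑ C : ι → A, (∏ k, p (C k)) *
      ∑ d, V (C m) b d * (if θ * ∑ a, p a * V a b d < V (C l) b d then 1 else 0) ≤ θ⁻¹ := by
    intro l hl
    rw [sum_prod_mul_eval₂ hp1 (Finset.ne_of_mem_erase hl) fun a a' => ∑ d, V a' b d *
      if θ * ∑ a, p a * V a b d < V a b d then 1 else 0]
    calc _ ≤ ∑ a, p a * θ⁻¹ := by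
          refine Finset.sum_le_sum fun a _ => mul_le_mul_of_nonneg_left ?_ (hp a)
          simp only [Finset.mul_sum]
          rw [Finset.sum_comm]
          calc _ ≤ ∑ d, θ⁻¹ * V a b d := by
                refine Finset.sum_le_sum fun d _ => ?_
                split_ifs with h
                · simp only [mul_one]
                  rw [← div_eq_inv_mul, le_div_iff₀ hθ, mul_comm, Finset.mul_sum]
                  exact h.le
                · simp only [mul_zero, Finset.sum_const_zero]
                  exact mul_nonneg (inv_nonneg.2 hθ.le) (hV _ _ _)
            _ = θ⁻¹ := by rw [← Finset.mul_sum, hV1, mul_one]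
      _ = θ⁻¹ := by rw [← Finset.sum_mul, hp1, one_mul]
  calc _ ≤ ∑ C : ι → A, ((∏ k, p (C k)) *
          (∑ d, V (C m) b d * if V (C m) b d ≤ θ * ∑ a, p a * V a b d then 1 else 0) +
        ∑ l ∈ Finset.univ.erase m, (∏ k, p (C k)) *
          ∑ d, V (C m) b d * (if θ * ∑ a, p a * V a b d < V (C l) b d then 1 else 0)) := by
        refine Finset.sum_le_sum fun C _ => ?_
        rw [← Finset.mul_sum, ← mul_add, Finset.sum_comm, ← Finset.sum_add_distrib]
        refine mul_le_mul_of_nonneg_left (Finset.sum_le_sum fun d _ => ?_) (hw C)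
        rw [← Finset.mul_sum, ← mul_add]
        exact mul_le_mul_of_nonneg_left (thresholdDecoder_error_le p V θ C m b d) (hV _ _ _)
    _ ≤ _ := by
        rw [Finset.sum_add_distrib, sum_prod_mul_eval hp1 m fun a =>
          ∑ d, V a b d * if V a b d ≤ θ * ∑ a, p a * V a b d then 1 else 0, Finset.sum_comm]
        refine add_le_add_right ((Finset.sum_le_sum hpair).trans ?_) _
        rw [Finset.sum_const, Finset.card_erase_of_mem (Finset.mem_univ _), Finset.card_univ,
          nsmul_eq_mul, Nat.cast_sub Fintype.card_pos, Nat.cast_one]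

theorem exists_le_of_weighted_sum_le {Ω : Type*} [Fintype Ω] {w f : Ω → ℝ} (hw : ∀ ω, 0 ≤ w ω)
    (hw1 : ∑ ω, w ω = 1) {ε : ℝ} (h : ∑ ω, w ω * f ω ≤ ε) : ∃ ω, f ω ≤ ε := by
  by_contra! hf
  obtain ⟨ω, -, hω⟩ := Finset.exists_ne_zero_of_sum_ne_zero (hw1 ▸ one_ne_zero)
  have : ∑ ω, w ω * ε < ∑ ω, w ω * f ω :=
    Finset.sum_lt_sum (fun ω _ => mul_le_mul_of_nonneg_left (hf ω).le (hw ω))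
      ⟨ω, Finset.mem_univ _, mul_lt_mul_of_pos_left (hf ω) ((hw ω).lt_of_ne hω.symm)⟩
  rw [← Finset.sum_mul, hw1, one_mul] at this
  linarith

open Classical in
/-- Probability that the likelihood ratio does not exceed `θ`. -/
noncomputable def thresholdFailure [Fintype B] (p : A → ℝ) (q : B → ℝ) (V : A → B → D → ℝ)
    (θ : ℝ) : ℝ :=
  ∑ b, q b * ∑ a, p a * ∑ d, V a b d * if V a b d ≤ θ * ∑ a, p a * V a b d then 1 else 0

-- One pair of codebooks must serve both directions, so the sum of both error probabilities is
-- averaged over the two codebooks jointly. In each direction the decoder's own codebook is held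
-- fixed first.
open Classical in
theorem exists_codebooks {κ E : Type*} [Fintype B] [Fintype E] [Fintype κ] [Nonempty ι]
    [Nonempty κ] [DecidableEq ι] [DecidableEq κ] {p : A → ℝ} (hp : ∀ a, 0 ≤ p a) (hp1 : ∑ a, p a = 1)
    {q : B → ℝ} (hq : ∀ b, 0 ≤ q b) (hq1 : ∑ b, q b = 1)
    {V : A → B → D → ℝ} (hV : ∀ a b d, 0 ≤ V a b d) (hV1 : ∀ a b, ∑ d, V a b d = 1)
    {U : B → A → E → ℝ} (hU : ∀ b a e, 0 ≤ U b a e) (hU1 : ∀ b a, ∑ e, U b a e = 1)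
    {θ η : ℝ} (hθ : 0 < θ) (hη : 0 < η) :
    ∃ (C : ι → A) (G : κ → B) (dec : κ → D → ι) (dec' : ι → E → κ),
      ∑ m, ∑ l, (Fintype.card ι : ℝ)⁻¹ * (Fintype.card κ : ℝ)⁻¹ *
        ((∑ d, V (C m) (G l) d * if dec l d ≠ m then 1 else 0) +
          ∑ e, U (G l) (C m) e * if dec' m e ≠ l then 1 else 0) ≤
      (thresholdFailure p q V θ + (Fintype.card ι - 1) * θ⁻¹) +
        (thresholdFailure q p U η + (Fintype.card κ - 1) * η⁻¹) := by
  have ha : (0 : ℝ) < Fintype.card ι := by exact_mod_cast Fintype.card_pos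
  have hb : (0 : ℝ) < Fintype.card κ := by exact_mod_cast Fintype.card_pos
  have hwC : ∀ C : ι → A, 0 ≤ ∏ k, p (C k) := fun C => Finset.prod_nonneg fun _ _ => hp _
  have hwG : ∀ G : κ → B, 0 ≤ ∏ k, q (G k) := fun G => Finset.prod_nonneg fun _ _ => hq _
  have h1 : ∀ m l, ∑ G : κ → B, (∏ k, q (G k)) * ∑ C : ι → A, (∏ k, p (C k)) *
      (∑ d, V (C m) (G l) d * if thresholdDecoder p V θ C (G l) d ≠ m then 1 else 0) ≤
      thresholdFailure p q V θ + (Fintype.card ι - 1) * θ⁻¹ := fun m l => by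
    refine (Finset.sum_le_sum fun G _ => mul_le_mul_of_nonneg_left
      (sum_codebook_error_le hp hp1 hV hV1 hθ m (G l)) (hwG G)).trans ?_
    simp only [mul_add, Finset.sum_add_distrib, ← Finset.sum_mul, sum_prod_eq_one hq1, one_mul]
    rw [sum_prod_mul_eval hq1 l fun b =>
      ∑ a, p a * ∑ d, V a b d * if V a b d ≤ θ * ∑ a, p a * V a b d then 1 else 0]
    rfl
  have h2 : ∀ m l, ∑ C : ι → A, (∏ k, p (C k)) * ∑ G : κ → B, (∏ k, q (G k)) *
      (∑ e, U (G l) (C m) e * if thresholdDecoder q U η G (C m) e ≠ l then 1 else 0) ≤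
      thresholdFailure q p U η + (Fintype.card κ - 1) * η⁻¹ := fun m l => by
    refine (Finset.sum_le_sum fun C _ => mul_le_mul_of_nonneg_left
      (sum_codebook_error_le hq hq1 hU hU1 hη l (C m)) (hwC C)).trans ?_
    simp only [mul_add, Finset.sum_add_distrib, ← Finset.sum_mul, sum_prod_eq_one hp1, one_mul]
    rw [sum_prod_mul_eval hp1 m fun a =>
      ∑ b, q b * ∑ e, U b a e * if U b a e ≤ η * ∑ b, q b * U b a e then 1 else 0]
    rfl
  have h3 : ∀ m l, ∑ ω : (ι → A) × (κ → B), ((∏ k, p (ω.1 k)) * ∏ k, q (ω.2 k)) *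
      ((∑ d, V (ω.1 m) (ω.2 l) d * if thresholdDecoder p V θ ω.1 (ω.2 l) d ≠ m then 1 else 0) +
        ∑ e, U (ω.2 l) (ω.1 m) e * if thresholdDecoder q U η ω.2 (ω.1 m) e ≠ l then 1 else 0) ≤
      (thresholdFailure p q V θ + (Fintype.card ι - 1) * θ⁻¹) +
        (thresholdFailure q p U η + (Fintype.card κ - 1) * η⁻¹) := fun m l => by
    simp only [mul_add _ (∑ d, _) (∑ e, _), Finset.sum_add_distrib]
    refine add_le_add (le_trans (le_of_eq ?_) (h1 m l)) (le_trans (le_of_eq ?_) (h2 m l))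
    · rw [Fintype.sum_prod_type_right]
      refine Finset.sum_congr rfl fun G _ => ?_
      rw [Finset.mul_sum]
      exact Finset.sum_congr rfl fun C _ => by ring
    · rw [Fintype.sum_prod_type]
      refine Finset.sum_congr rfl fun C _ => ?_
      rw [Finset.mul_sum]
      exact Finset.sum_congr rfl fun G _ => by ring
  obtain ⟨ω, hω⟩ := exists_le_of_weighted_sum_le (Ω := (ι → A) × (κ → B))
    (w := fun ω => (∏ k, p (ω.1 k)) * ∏ k, q (ω.2 k))
    (f := fun ω => ∑ m, ∑ l, (Fintype.card ι : ℝ)⁻¹ * (Fintype.card κ : ℝ)⁻¹ *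
      ((∑ d, V (ω.1 m) (ω.2 l) d * if thresholdDecoder p V θ ω.1 (ω.2 l) d ≠ m then 1 else 0) +
        ∑ e, U (ω.2 l) (ω.1 m) e * if thresholdDecoder q U η ω.2 (ω.1 m) e ≠ l then 1 else 0))
    (ε := (thresholdFailure p q V θ + (Fintype.card ι - 1) * θ⁻¹) +
        (thresholdFailure q p U η + (Fintype.card κ - 1) * η⁻¹))
    (fun ω => mul_nonneg (hwC _) (hwG _))
    (by
      rw [Fintype.sum_prod_type]
      simp only [← Finset.mul_sum, sum_prod_eq_one hq1, mul_one, sum_prod_eq_one hp1])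
    (by
      simp only [Finset.mul_sum (Finset.univ : Finset ι), Finset.mul_sum (Finset.univ : Finset κ)]
      rw [Finset.sum_comm]
      calc _ ≤ ∑ m : ι, ∑ l : κ, (Fintype.card ι : ℝ)⁻¹ * (Fintype.card κ : ℝ)⁻¹ *
            ((thresholdFailure p q V θ + (Fintype.card ι - 1) * θ⁻¹) +
              (thresholdFailure q p U η + (Fintype.card κ - 1) * η⁻¹)) := by
            refine Finset.sum_le_sum fun m _ => ?_
            rw [Finset.sum_comm]
            refine Finset.sum_le_sum fun l _ => ?_
            refine le_trans (le_of_eq ?_) (mul_le_mul_of_nonneg_left (h3 m l) (by positivity))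
            rw [Finset.mul_sum]
            exact Finset.sum_congr rfl fun ω _ => by ring
        _ = _ := by
            simp only [Finset.sum_const, Finset.card_univ, nsmul_eq_mul]
            field_simp)
  exact ⟨ω.1, ω.2, _, _, hω⟩

end OneShot

open Filter Topology

-- Threshold decoding over many channel uses.

section Threshold

variable {X X' Y : Type*} [Fintype X] [Fintype X'] [Fintype Y]

theorem sum_prod_log_eq {p : X → ℝ} {q : X' → ℝ} {V : X → X' → Y → ℝ} (hp1 : ∑ x, p x = 1)
    (hV1 : ∀ x x', ∑ y, V x x' y = 1) :
    ∑ ω : X' × X × Y, q ω.1 * (p ω.2.1 * V ω.2.1 ω.1 ω.2.2) *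
        Real.logb 2 (V ω.2.1 ω.1 ω.2.2 / ∑ x, p x * V x ω.1 ω.2.2) =
      condMutualInfo fun x y x' => p x * q x' * V x x' y := by
  rw [condMutualInfo_eq_sum_log (P := fun x x' => p x * q x') (V := V) hV1]
  simp only [Fintype.sum_prod_type]
  rw [Finset.sum_comm]
  refine Finset.sum_congr rfl fun x _ => Finset.sum_congr rfl fun x' _ =>
    Finset.sum_congr rfl fun y _ => ?_
  by_cases h : q x' = 0
  · simp [h]
  have hQ : outputGiven (fun x x' => p x * q x') V x' y = ∑ x, p x * V x x' y := by
    simp only [outputGiven, mul_right_comm _ (q x'), ← Finset.sum_mul, hp1, one_mul]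
    exact mul_div_cancel_right₀ _ h
  rw [hQ]
  ring

/-- Repackage a triple of sequences as a sequence of triples. -/
def tripleEquiv (n : ℕ) (A B C : Type*) :
    (Fin n → A × B × C) ≃ (Fin n → A) × (Fin n → B) × (Fin n → C) where
  toFun z := (fun i => (z i).1, fun i => (z i).2.1, fun i => (z i).2.2)
  invFun w i := (w.1 i, w.2.1 i, w.2.2 i)
  left_inv _ := rfl
  right_inv _ := rfl

open Classical in
theorem thresholdFailure_prod_eq (p : X → ℝ) (q : X' → ℝ) (V : X → X' → Y → ℝ) (n : ℕ) (θ : ℝ) :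
    thresholdFailure (fun a : Fin n → X => ∏ i, p (a i)) (fun b : Fin n → X' => ∏ i, q (b i))
        (fun a b (d : Fin n → Y) => ∏ i, V (a i) (b i) (d i)) θ =
      ∑ z : Fin n → X' × X × Y, if ∏ i, V (z i).2.1 (z i).1 (z i).2.2 ≤
          θ * ∏ i, ∑ x, p x * V x (z i).1 (z i).2.2 then
        ∏ i, q (z i).1 * (p (z i).2.1 * V (z i).2.1 (z i).1 (z i).2.2) else 0 := by
  rw [← (tripleEquiv n X' X Y).symm.sum_comp]
  unfold thresholdFailure
  simp only [Fintype.sum_prod_type, Finset.mul_sum (Finset.univ : Finset (Fin n → Y)),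
    Finset.mul_sum _ _ (∏ i, q _)]
  refine Finset.sum_congr rfl fun b _ => Finset.sum_congr rfl fun a _ =>
    Finset.sum_congr rfl fun d _ => ?_
  have h : ∑ a : Fin n → X, (∏ i, p (a i)) * ∏ i, V (a i) (b i) (d i) =
      ∏ i, ∑ x, p x * V x (b i) (d i) := by
    rw [← sum_prod_eq_prod_sum]
    simp only [Finset.prod_mul_distrib]
  rw [h, mul_ite, mul_ite, mul_ite, mul_one, mul_zero, mul_zero, mul_zero]
  simp only [tripleEquiv, Equiv.coe_fn_symm_mk, Finset.prod_mul_distrib]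

/-- After taking logarithms, failure says that the empirical mean of the information densities of
i.i.d. triples is at most `t`, below its expectation. Chebyshev bounds this by `K / n`. -/
theorem tendsto_thresholdFailure {p : X → ℝ} {q : X' → ℝ} {V : X → X' → Y → ℝ}
    (hp : ∀ x, 0 ≤ p x) (hp1 : ∑ x, p x = 1) (hq : ∀ x, 0 ≤ q x) (hq1 : ∑ x, q x = 1)
    (hV : ∀ x x' y, 0 ≤ V x x' y) (hV1 : ∀ x x', ∑ y, V x x' y = 1) {t : ℝ}
    (ht : t < condMutualInfo fun x y x' => p x * q x' * V x x' y) :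
    Tendsto (fun n : ℕ => thresholdFailure (fun a : Fin n → X => ∏ i, p (a i))
      (fun b : Fin n → X' => ∏ i, q (b i)) (fun a b (d : Fin n → Y) => ∏ i, V (a i) (b i) (d i))
      ((2 : ℝ) ^ ((n : ℝ) * t))) atTop (𝓝 0) := by
  classical
  set P : X' × X × Y → ℝ := fun ω => q ω.1 * (p ω.2.1 * V ω.2.1 ω.1 ω.2.2) with hPdef
  set φ : X' × X × Y → ℝ := fun ω =>
    Real.logb 2 (V ω.2.1 ω.1 ω.2.2 / ∑ x, p x * V x ω.1 ω.2.2) with hφ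
  have hP0 : ∀ ω, 0 ≤ P ω := fun ω => mul_nonneg (hq _) (mul_nonneg (hp _) (hV _ _ _))
  have hP1 : ∑ ω, P ω = 1 := by
    simp only [hPdef, Fintype.sum_prod_type, ← Finset.mul_sum, hV1, mul_one, hp1, hq1]
  rw [← sum_prod_log_eq hp1 hV1] at ht
  set K : ℝ := (∑ a, P a * (φ a - ∑ b, P b * φ b) ^ 2) / (∑ a, P a * φ a - t) ^ 2
  have hK : Tendsto (fun n : ℕ => K * (n : ℝ)⁻¹) atTop (𝓝 0) := by
    simpa using tendsto_inv_atTop_nhds_zero_nat.const_mul K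
  refine tendsto_of_tendsto_of_tendsto_of_le_of_le' tendsto_const_nhds hK ?_ ?_
  · refine Eventually.of_forall fun n => ?_
    rw [thresholdFailure_prod_eq]
    exact Finset.sum_nonneg fun z _ => by
      split_ifs
      · exact Finset.prod_nonneg fun i _ => hP0 (z i)
      · exact le_rfl
  filter_upwards [eventually_gt_atTop 0] with n hn
  have : Nonempty (Fin n) := ⟨⟨0, hn⟩⟩
  have htail := sum_prod_tail_le (ι := Fin n) hP0 hP1 φ ht
  rw [Fintype.card_fin] at htail
  refine le_trans ?_ htail
  rw [thresholdFailure_prod_eq]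
  refine Finset.sum_le_sum fun z _ => ?_
  have h0 : 0 ≤ ∏ i, P (z i) := Finset.prod_nonneg fun i _ => hP0 (z i)
  -- On sequences of probability zero some logarithms may be default values and the two events need
  -- not agree.
  by_cases hz : ∏ i, P (z i) = 0
  · rw [hz]
    split_ifs <;> exact le_rfl
  split_ifs with h1 h2
  · exact le_rfl
  · refine absurd ?_ h2
    have hne : ∀ i, P (z i) ≠ 0 := fun i => (Finset.prod_ne_zero_iff.1 hz) i (Finset.mem_univ i)
    have hVne : ∀ i, V (z i).2.1 (z i).1 (z i).2.2 ≠ 0 := fun i =>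
      right_ne_zero_of_mul (right_ne_zero_of_mul (hne i))
    have hQpos : ∀ i, 0 < ∑ x, p x * V x (z i).1 (z i).2.2 := fun i =>
      sum_pos_of_mem_support (fun x => mul_nonneg (hp x) (hV _ _ _))
        (right_ne_zero_of_mul (hne i))
    rw [← Real.logb_prod _ _ fun i _ => div_ne_zero (hVne i) (hQpos i).ne']
    have hpos : 0 < ∏ i, V (z i).2.1 (z i).1 (z i).2.2 / ∑ x, p x * V x (z i).1 (z i).2.2 :=
      Finset.prod_pos fun i _ => div_pos ((hV _ _ _).lt_of_ne (hVne i).symm) (hQpos i)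
    rw [Real.logb_le_iff_le_rpow one_lt_two hpos, Finset.prod_div_distrib,
      div_le_iff₀ (Finset.prod_pos fun i _ => hQpos i)]
    exact h1
  · exact h0
  · exact le_rfl

end Threshold

/-- For `R < I` the midpoint makes the union bound decay exponentially. At rate zero there is
exactly one message and the term vanishes for every `t`; this covers `I = 0`, where no nonnegative
rate is strictly below `I`. -/
theorem exists_threshold {R I : ℝ} (h : R = 0 ∨ (0 ≤ R ∧ R < I)) :
    ∃ t < I, Tendsto (fun n : ℕ => ((numMessages n R : ℝ) - 1) * ((2 : ℝ) ^ ((n : ℝ) * t))⁻¹)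
      atTop (𝓝 0) := by
  rcases h with rfl | ⟨h0, h⟩
  · refine ⟨I - 1, by linarith, ?_⟩
    simp [numMessages]
  · refine ⟨(R + I) / 2, by linarith, ?_⟩
    have hr : Tendsto (fun n : ℕ => ((2 : ℝ) ^ (-((I - R) / 2))) ^ n) atTop (𝓝 0) :=
      tendsto_pow_atTop_nhds_zero_of_lt_one (by positivity)
        (Real.rpow_lt_one_of_one_lt_of_neg one_lt_two (by linarith))
    refine squeeze_zero (fun n => ?_) (fun n => ?_) hr
    · have : (1 : ℝ) ≤ numMessages n R := by exact_mod_cast numMessages_pos n h0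
      exact mul_nonneg (by linarith) (by positivity)
    · have hM : (numMessages n R : ℝ) ≤ (2 : ℝ) ^ ((n : ℝ) * R) :=
        Nat.floor_le (by positivity)
      rw [← Real.rpow_neg two_pos.le, ← Real.rpow_natCast, ← Real.rpow_mul two_pos.le]
      calc ((numMessages n R : ℝ) - 1) * (2 : ℝ) ^ (-((n : ℝ) * ((R + I) / 2)))
          ≤ (2 : ℝ) ^ ((n : ℝ) * R) * (2 : ℝ) ^ (-((n : ℝ) * ((R + I) / 2))) :=
            mul_le_mul_of_nonneg_right (by linarith) (by positivity)
        _ = _ := by rw [← Real.rpow_add two_pos]; congr 1; ring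

-- The inner bound.

section Coding

variable {X₁ X₂ Y₁ Y₂ : Type*} [Fintype Y₁] [Fintype Y₂]

/-- The code that transmits codewords without using the received outputs. -/
def Code.ofCodebooks {n : ℕ} {R₁ R₂ : ℝ} (C : Fin (numMessages n R₁) → Fin n → X₁)
    (G : Fin (numMessages n R₂) → Fin n → X₂)
    (dec₂ : Fin (numMessages n R₂) → (Fin n → Y₂) → Fin (numMessages n R₁))
    (dec₁ : Fin (numMessages n R₁) → (Fin n → Y₁) → Fin (numMessages n R₂)) :
    Code X₁ X₂ Y₁ Y₂ n R₁ R₂ where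
  enc₁ i m _ := C m i
  enc₂ i m _ := G m i
  dec₁ := dec₁
  dec₂ := dec₂

/-- Union bound over the two decoders. Since the encoders ignore the outputs, summing out one user's
sequence leaves a product of marginal channels. -/
theorem Code.errorProb_ofCodebooks_le (W : Channel X₁ X₂ Y₁ Y₂) {n : ℕ} {R₁ R₂ : ℝ}
    (C : Fin (numMessages n R₁) → Fin n → X₁) (G : Fin (numMessages n R₂) → Fin n → X₂)
    (dec₂ : Fin (numMessages n R₂) → (Fin n → Y₂) → Fin (numMessages n R₁))
    (dec₁ : Fin (numMessages n R₁) → (Fin n → Y₁) → Fin (numMessages n R₂)) :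
    (Code.ofCodebooks C G dec₂ dec₁).errorProb W ≤
      ∑ m, ∑ l, (numMessages n R₁ : ℝ)⁻¹ * (numMessages n R₂ : ℝ)⁻¹ *
        ((∑ d, (∏ i, W.toUser2 (C m i) (G l i) (d i)) * if dec₂ l d ≠ m then 1 else 0) +
          ∑ e, (∏ i, W.toUser1 (C m i) (G l i) (e i)) * if dec₁ m e ≠ l then 1 else 0) := by
  unfold Code.errorProb
  refine Finset.sum_le_sum fun m _ => Finset.sum_le_sum fun l _ =>
    mul_le_mul_of_nonneg_left ?_ (by positivity)
  have h2 : ∀ d : Fin n → Y₂, ∏ i, W.toUser2 (C m i) (G l i) (d i) =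
      ∑ e : Fin n → Y₁, ∏ i, (W (C m i) (G l i)).1 (e i, d i) := fun d =>
    (sum_prod_eq_prod_sum fun i y => (W (C m i) (G l i)).1 (y, d i)).symm
  have h1 : ∀ e : Fin n → Y₁, ∏ i, W.toUser1 (C m i) (G l i) (e i) =
      ∑ d : Fin n → Y₂, ∏ i, (W (C m i) (G l i)).1 (e i, d i) := fun e =>
    (sum_prod_eq_prod_sum fun i y => (W (C m i) (G l i)).1 (e i, y)).symm
  simp only [h1, h2, Finset.sum_mul]
  rw [Finset.sum_comm (s := (Finset.univ : Finset (Fin n → Y₂))), ← Finset.sum_add_distrib]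
  refine Finset.sum_le_sum fun e _ => ?_
  rw [← Finset.sum_add_distrib]
  refine Finset.sum_le_sum fun d _ => ?_
  have h0 : 0 ≤ ∏ i, (W (C m i) (G l i)).1 (e i, d i) :=
    Finset.prod_nonneg fun i _ => (W (C m i) (G l i)).2.1 _
  change (if dec₂ l d ≠ m ∨ dec₁ m e ≠ l then ∏ i, (W (C m i) (G l i)).1 (e i, d i) else 0) ≤ _
  by_cases ha : dec₂ l d ≠ m <;> by_cases hb : dec₁ m e ≠ l <;> simp [ha, hb, h0]

variable [Fintype X₁] [Fintype X₂]

theorem achievable_of_lt_info (W : Channel X₁ X₂ Y₁ Y₂) (P₁ : ProbDist X₁) (P₂ : ProbDist X₂)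
    {R : ℝ × ℝ} (h₁ : R.1 = 0 ∨ (0 ≤ R.1 ∧ R.1 < infoX1Y2 (P₁.prod P₂) W))
    (h₂ : R.2 = 0 ∨ (0 ≤ R.2 ∧ R.2 < infoX2Y1 (P₁.prod P₂) W)) : Achievable W R := by
  have hR₁ : 0 ≤ R.1 := h₁.elim (fun h => h.ge) And.left
  have hR₂ : 0 ≤ R.2 := h₂.elim (fun h => h.ge) And.left
  obtain ⟨t, ht, htM⟩ := exists_threshold h₁
  obtain ⟨s, hs, hsM⟩ := exists_threshold h₂
  have hF := tendsto_thresholdFailure (V := W.toUser2) P₁.2.1 P₁.2.2 P₂.2.1 P₂.2.2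
    W.toUser2_nonneg W.sum_toUser2 ht
  have hs' : s < condMutualInfo fun x₂ y x₁ => P₂.1 x₂ * P₁.1 x₁ * W.toUser1 x₁ x₂ y := by
    simpa only [infoX2Y1, ProbDist.prod, mul_comm (P₁.1 _)] using hs
  have hG := tendsto_thresholdFailure (V := fun x₂ x₁ => W.toUser1 x₁ x₂) P₂.2.1 P₂.2.2 P₁.2.1
    P₁.2.2 (fun _ _ => W.toUser1_nonneg _ _) (fun _ _ => W.sum_toUser1 _ _) hs'
  have hcode : ∀ n : ℕ, ∃ c : Code X₁ X₂ Y₁ Y₂ n R.1 R.2, c.errorProb W ≤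
      (thresholdFailure (fun a : Fin n → X₁ => ∏ i, P₁.1 (a i))
        (fun b : Fin n → X₂ => ∏ i, P₂.1 (b i))
        (fun a b (d : Fin n → Y₂) => ∏ i, W.toUser2 (a i) (b i) (d i)) ((2 : ℝ) ^ ((n : ℝ) * t)) +
          ((numMessages n R.1 : ℝ) - 1) * ((2 : ℝ) ^ ((n : ℝ) * t))⁻¹) +
      (thresholdFailure (fun a : Fin n → X₂ => ∏ i, P₂.1 (a i))
        (fun b : Fin n → X₁ => ∏ i, P₁.1 (b i))
        (fun a b (d : Fin n → Y₁) => ∏ i, W.toUser1 (b i) (a i) (d i)) ((2 : ℝ) ^ ((n : ℝ) * s)) +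
          ((numMessages n R.2 : ℝ) - 1) * ((2 : ℝ) ^ ((n : ℝ) * s))⁻¹) := fun n => by
    have : Nonempty (Fin (numMessages n R.1)) := ⟨⟨0, numMessages_pos n hR₁⟩⟩
    have : Nonempty (Fin (numMessages n R.2)) := ⟨⟨0, numMessages_pos n hR₂⟩⟩
    obtain ⟨C, G, dec, dec', h⟩ := exists_codebooks (ι := Fin (numMessages n R.1))
      (κ := Fin (numMessages n R.2)) (p := fun a : Fin n → X₁ => ∏ i, P₁.1 (a i))
      (q := fun b : Fin n → X₂ => ∏ i, P₂.1 (b i))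
      (V := fun a b (d : Fin n → Y₂) => ∏ i, W.toUser2 (a i) (b i) (d i))
      (U := fun b a (e : Fin n → Y₁) => ∏ i, W.toUser1 (a i) (b i) (e i))
      (fun _ => Finset.prod_nonneg fun _ _ => P₁.2.1 _) (sum_prod_eq_one P₁.2.2)
      (fun _ => Finset.prod_nonneg fun _ _ => P₂.2.1 _) (sum_prod_eq_one P₂.2.2)
      (fun _ _ _ => Finset.prod_nonneg fun _ _ => W.toUser2_nonneg _ _ _)
      (fun a b => by
        rw [sum_prod_eq_prod_sum fun i y => W.toUser2 (a i) (b i) y]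
        simp only [W.sum_toUser2, Finset.prod_const_one])
      (fun _ _ _ => Finset.prod_nonneg fun _ _ => W.toUser1_nonneg _ _ _)
      (fun b a => by
        rw [sum_prod_eq_prod_sum fun i y => W.toUser1 (a i) (b i) y]
        simp only [W.sum_toUser1, Finset.prod_const_one])
      (Real.rpow_pos_of_pos two_pos ((n : ℝ) * t)) (Real.rpow_pos_of_pos two_pos ((n : ℝ) * s))
    simp only [Fintype.card_fin] at h
    exact ⟨Code.ofCodebooks C G dec dec', (Code.errorProb_ofCodebooks_le W C G dec dec').trans h⟩
  choose c hc using hcode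
  refine ⟨hR₁, hR₂, c, squeeze_zero (fun n => ?_) hc ?_⟩
  · rw [Code.errorProb_eq]
    exact Finset.sum_nonneg fun ω _ => by
      split_ifs
      · exact (c n).law_nonneg W ω
      · exact le_rfl
  · simpa using (hF.add htM).add (hG.add hsM)

/-- Scaling by `s < 1` brings positive rates strictly below their bounds and leaves zero rates at
zero, the two cases allowed by `achievable_of_lt_info`. -/
theorem rateRegion_prod_subset_closure (W : Channel X₁ X₂ Y₁ Y₂) (P₁ : ProbDist X₁)
    (P₂ : ProbDist X₂) : rateRegion (P₁.prod P₂) W ⊆ closure {R | Achievable W R} := by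
  rintro R ⟨h1, h2, h3, h4⟩
  have hlim : Tendsto (fun s : ℝ => s • R) (𝓝[<] 1) (𝓝 R) := by
    have : Tendsto (fun s : ℝ => s • R) (𝓝 1) (𝓝 ((1 : ℝ) • R)) :=
      (continuous_id.smul continuous_const).tendsto 1
    rw [one_smul] at this
    exact this.mono_left nhdsWithin_le_nhds
  refine mem_closure_of_tendsto hlim ?_
  filter_upwards [Ioo_mem_nhdsLT (zero_lt_one' ℝ)] with s hs
  have key : ∀ {r I : ℝ}, 0 ≤ r → r ≤ I → s * r = 0 ∨ (0 ≤ s * r ∧ s * r < I) := fun {r I} h h' => by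
    rcases h.eq_or_lt with rfl | hr
    · exact Or.inl (mul_zero s)
    · exact Or.inr ⟨mul_nonneg hs.1.le h, (mul_lt_of_lt_one_left hr hs.2).trans_le h'⟩
  exact achievable_of_lt_info W P₁ P₂ (key h1 h3) (key h2 h4)

theorem innerBound_subset_capacityRegion (W : Channel X₁ X₂ Y₁ Y₂) :
    innerBound W ⊆ capacityRegion W :=
  coBar_subset_coBar <| Set.iUnion₂_subset fun P₁ P₂ =>
    (rateRegion_prod_subset_closure W P₁ P₂).trans (closure_mono (subset_convexHull ℝ _))

end Coding

end TWC

-- Collapse of the chain of inclusions.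

theorem theorem4 {X₁ X₂ Y₁ Y₂ : Type*} [Fintype X₁] [Fintype X₂] [Fintype Y₁] [Fintype Y₂]
    (W : TWC.Channel X₁ X₂ Y₁ Y₂) (Pstar : TWC.ProbDist X₁)
    -- (i): a common maximizer of `I(X₁; Y₂ | X₂ = x₂)` over `P_{X₁|X₂=x₂}`, for all `x₂`
    (hmax : ∀ (x₂ : X₂) (Q : TWC.ProbDist X₁),
      TWC.mutualInfo Q.1 (fun x₁ => W.toUser2 x₁ x₂) ≤
        TWC.mutualInfo Pstar.1 (fun x₁ => W.toUser2 x₁ x₂))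
    -- (ii), first part: `H(Y₁ | X₁, X₂)` does not depend on `P_{X₁|X₂}`, given `P_{X₂}`
    (hinv : ∀ P Q : TWC.ProbDist (X₁ × X₂), P.snd = Q.snd →
      TWC.entropyY1X1X2 P W = TWC.entropyY1X1X2 Q W)
    -- (ii), second part
    (hent : ∀ P : TWC.ProbDist (X₁ × X₂),
      TWC.entropyY1X1 P W ≤ TWC.entropyY1X1 (Pstar.prod P.snd) W) :
    TWC.capacityRegion W = TWC.innerBound W ∧
      TWC.innerBound W = TWC.outerBound W ∧
      TWC.capacityRegion W =
        TWC.coBar (⋃ P₂ : TWC.ProbDist X₂, TWC.rateRegion (Pstar.prod P₂) W) := by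
  have hIC := TWC.innerBound_subset_capacityRegion W
  have hCO := TWC.capacityRegion_subset_outerBound W
  have hOS : TWC.outerBound W ⊆
      TWC.coBar (⋃ P₂ : TWC.ProbDist X₂, TWC.rateRegion (Pstar.prod P₂) W) :=
    TWC.coBar_subset_coBar <| Set.iUnion_subset fun P =>
      (TWC.rateRegion_subset_of_conditions W Pstar hmax hinv hent P).trans <|
        (Set.subset_iUnion (fun P₂ => TWC.rateRegion (Pstar.prod P₂) W) P.snd).trans
          (TWC.subset_coBar _)
  have hSI : TWC.coBar (⋃ P₂ : TWC.ProbDist X₂, TWC.rateRegion (Pstar.prod P₂) W) ⊆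
      TWC.innerBound W :=
    TWC.coBar_subset_coBar <| Set.iUnion_subset fun P₂ =>
      (Set.subset_iUnion₂ (s := fun P₁ P₂ => TWC.rateRegion (TWC.ProbDist.prod P₁ P₂) W)
        Pstar P₂).trans (TWC.subset_coBar _)
  exact ⟨(hCO.trans (hOS.trans hSI)).antisymm hIC,
    (hIC.trans hCO).antisymm (hOS.trans hSI), (hCO.trans hOS).antisymm (hSI.trans hIC)⟩
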